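/- Notation: $\{x\}=x-x^{-1}$, $D=\{A\}/\{q\}$, $\phi=A\{q\}$, $\bar\phi=-A^{-1}\{q\}$. An antiparallel lock is a tangle of two oppositely directed strands that cross twice, both crossings having the same sign (the sign of the lock). For a link diagram made of antiparallel locks, let $$P=\sum D^{a}\phi^{b}\bar\phi^{\,c}$$ be the sum over all planar resolutions of the diagram: every lock is replaced either by the planar pair of arcs joining the same ends as its two strands (coefficient $1$), or by the pair of arcs joining each incoming end to the other strand's outgoing end (coefficient $\phi$ for a positive and $\bar\phi$ for a negative lock); $a$ is the number of cycles of the resolution. For $n\in\mathbb Z$ put $$\Phi_n=\frac{(1+\phi D)^n-1}{D}\ (n\ge 0),\qquad \Phi_{-n}=\frac{(1+\bar\phi D)^{n}-1}{D}\ (n>0).$$ For $m,n\in\mathbb Z$ let $DB(2m,2n)$ be the double braid knot, composed of two orthogonal chains of $|m|$ and $|n|$ antiparallel locks, whose signs are the signs of $m$ and $n$. Let $APT[2,2n]$ be the two-component antiparallel torus link, the closure of a chain of $|n|$ locks. Let $H^{L}\in\mathbb Q(q)[A,A^{-1}]$ be the fundamental HOMFLY polynomial of $L$ in the topological framing, with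 $H^{\rm unknot}=D$: the Laurent polynomial in $A$ whose value at $A=q^N$ is, for every $N\ge1$, $A^{-w}$ ($w$ the writhe) times the Reshetikhin--Turaev value of the diagram for the fundamental representation of $\mathfrak{sl}_q(N)$. Then for all $m,n\in\mathbb Z$: (1) For independent $D,\phi,\bar\phi$ (in any commutative ring, with $\Phi_n$ read as a polynomial in them), $$P^{DB(2m,2n)}=D+(\Phi_n+\Phi_m)D^2+\Phi_n\Phi_mD .$$ (2) The HOMFLY polynomial of $DB(2m,2n)$ exists, is unique, and, with $D,\phi,\bar\phi$ as above, $$H^{DB(2m,2n)}=A^{-2n-2m}P^{DB(2m,2n)}=A^{-2n-2m}D\Big((1+\phi D)^n+(1+\phi D)^m+D^{-2}[(1+\phi D)^n-1][(1+\phi D)^m-1]-1\Big)$$ $$=D\Big(1-(1-A^{-2m})(1-A^{-2n})\frac{\{Aq\}\{A/q\}}{\{A\}^2}\Big).$$ (3) Define the cyclotomic function $F^{K}\in\mathbb Q(q)[A,A^{-1}]$ of a knot $K$ by $H^{K}=D(1+\{Aq\}\{A/q\}F^{K})$, and that of a two-component link $L$ by $H^{L}=D^2\big(1+\frac{\{Aq\}\{A/q\}}{\{A\}}F^{L}\big)$.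 For $DB(2m,2n)$ and $APT[2,2n]$ they exist and are unique, and $$F^{DB(2m,2n)}=\frac{A^{-2n-2m}\big(1+\Phi_n\Phi_m+(\Phi_n+\Phi_m)D\big)-1}{\{Aq\}\{A/q\}}=-\frac{(1-A^{-2m})(1-A^{-2n})}{\{A\}^2},\qquad F^{APT[2,2n]}=\frac{A^{-2n}-1}{\{A\}},$$ so that $F^{DB(2m,2n)}=-F^{APT[2,2m]}F^{APT[2,2n]}$. (4) For the twist knots ${\rm Tw}_{2n}=DB(2,2n)$ and $\overline{\rm Tw}_{-2n}=DB(-2,2n)$ with the two orientations of the lock element, $$H^{{\rm Tw}_{2n}}=D\Big(A^{-2}+A^{-1}\frac{\{q\}^2}{\{A\}}+\frac{\{A/q\}\{Aq\}}{\{A\}}A^{-2n-1}\Big),$$ $$H^{\overline{\rm Tw}_{-2n}}=D\Big(A^{2}-A\frac{\{q\}^2}{\{A\}}-\frac{\{A/q\}\{Aq\}}{\{A\}}A^{-2n+1}\Big).$$ -/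

import Mathlib

/-! ## Oriented tangle diagrams in sliced form -/

namespace BipartiteLinks

/-- Direction of a strand where it crosses a horizontal level. -/
inductive Dir
  | up
  | down

/-- The opposite direction. -/
def Dir.flip : Dir → Dir
  | .up => .down
  | .down => .up

/-- The sign of a crossing or of a lock. -/
inductive Sgn
  | pos
  | neg

open Dir

/-- Oriented planar tangle diagrams in sliced form, with vertices of the kinds listed in `V`.
`Tangle V s t` are the diagrams whose ends on the top line are, from left to right, directed as in
the word `s`, and whose ends on the bottom line are directed as in `t`.
`cap a` is the arc `∩` whose left leg has direction `a`, `cup a` is the arc `∪` whose left leg has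
direction `a`, `comp S T` is `S` on top of `T`, and `tensor S T` is `S` to the left of `T`. -/
inductive Tangle (V : List Dir → List Dir → Type) : List Dir → List Dir → Type
  | id (w : List Dir) : Tangle V w w
  | cap (a : Dir) : Tangle V [] [a, a.flip]
  | cup (a : Dir) : Tangle V [a, a.flip] []
  | vertex {s t : List Dir} (v : V s t) : Tangle V s t
  | comp {s t u : List Dir} (S : Tangle V s t) (T : Tangle V t u) : Tangle V s u
  | tensor {s t s' t' : List Dir} (S : Tangle V s t) (T : Tangle V s' t') :
      Tangle V (s ++ s') (t ++ t')

/-- Closed diagrams. -/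
abbrev Closed (V : List Dir → List Dir → Type) : Type := Tangle V [] []

/-- Vertices of planar diagrams: there are none. -/
inductive NoVertex : List Dir → List Dir → Type

/-- Vertices of link diagrams: a positive or a negative crossing of two strands that both go up
(in a positive crossing the strand from bottom left to top right is over the other one).
Crossings in other positions are obtained by bending the strands. -/
inductive Crossing : List Dir → List Dir → Type
  | crossing (e : Sgn) : Crossing [up, up] [up, up]

/-- Vertices of lock diagrams: the vertical and the horizontal antiparallel lock, of either sign,
entered at the corners NW, SE and left at the corners NE, SW. -/
inductive Lock : List Dir → List Dir → Type
  | vert (e : Sgn) : Lock [down, up] [down, up]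
  | horiz (e : Sgn) : Lock [down, up] [down, up]

/-- Oriented link diagrams. -/
abbrev LinkDiagram : Type := Closed Crossing

/-- Lock (bipartite) diagrams. -/
abbrev LockDiagram : Type := Closed Lock

namespace Tangle

variable {V W : List Dir → List Dir → Type}

/-- Substitute a tangle diagram for every vertex. -/
def subst (f : ∀ s t : List Dir, V s t → Tangle W s t) :
    {s t : List Dir} → Tangle V s t → Tangle W s t
  | _, _, .id w => .id w
  | _, _, .cap a => .cap a
  | _, _, .cup a => .cup a
  | s, t, .vertex v => f s t v
  | _, _, .comp S T => .comp (subst f S) (subst f T)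
  | _, _, .tensor S T => .tensor (subst f S) (subst f T)

/-- The planar tangle with an upper arc from NW to NE and a lower arc from SE to SW. -/
def smoothH : Tangle V [down, up] [down, up] :=
  .comp (.cup down) (.cap down)

/-- The planar tangle with two vertical arcs, the left one going down and the right one up. -/
def smoothV : Tangle V [down, up] [down, up] := .id [down, up]

/-- Join two tangles side by side: the right ends of `S` are joined to the left ends of `T`. -/
def sideBySide (S T : Tangle V [down, up] [down, up]) : Tangle V [down, up] [down, up] :=
  .comp (t := [down, up, down, up])
    (.tensor (s := [down]) (t := [down]) (s' := [up]) (t' := [up, down, up]) (.id [down])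
      (.tensor (s := []) (t := [up, down]) (.cap up) (.id [up])))
    (.comp (t := [down, up, down, up])
      (.tensor S T)
      (.tensor (s := [down]) (t := [down]) (s' := [up, down, up]) (t' := [up]) (.id [down])
        (.tensor (s := [up, down]) (t := []) (.cup up) (.id [up]))))

/-- Close a tangle by joining its top ends to its bottom ends by two nested arcs on the right. -/
def close (T : Tangle V [down, up] [down, up]) : Closed V :=
  .comp (t := [down, up]) (.cap down)
    (.comp (t := [down, up, down, up])
      (.tensor (s := [down]) (t := [down]) (s' := [up]) (t' := [up, down, up]) (.id [down])
        (.tensor (s := []) (t := [up, down]) (.cap up) (.id [up])))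
      (.comp (t := [down, up, down, up])
        (.tensor T (.id [down, up]))
        (.comp (t := [down, up])
          (.tensor (s := [down]) (t := [down]) (s' := [up, down, up]) (t' := [up]) (.id [down])
            (.tensor (s := [up, down]) (t := []) (.cup up) (.id [up])))
          (.cup down))))

end Tangle

open Tangle

/-! ## From lock diagrams to link diagrams -/

/-- A crossing of two strands that go up. -/
def crossUp (e : Sgn) : Tangle Crossing [up, up] [up, up] := .vertex (.crossing e)

/-- A crossing of two strands that go down: `crossUp` turned by 180 degrees. -/
def crossDown (e : Sgn) : Tangle Crossing [down, down] [down, down] :=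
  .comp (t := [down, down, up, down])
    (.tensor (s := [down, down]) (t := [down, down]) (s' := []) (t' := [up, down])
      (.id [down, down]) (.cap up))
    (.comp (t := [down, down, up, up, down, down])
      (.tensor (s := [down, down, up]) (t := [down, down, up]) (s' := [down])
        (t' := [up, down, down]) (.id [down, down, up])
        (.tensor (s := []) (t := [up, down]) (.cap up) (.id [down])))
      (.comp (t := [down, down, up, up, down, down])
        (.tensor (s := [down, down]) (t := [down, down]) (s' := [up, up, down, down])
          (t' := [up, up, down, down]) (.id [down, down])
          (.tensor (crossUp e) (.id [down, down])))
        (.comp (t := [down, up, down, down])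
          (.tensor (s := [down]) (t := [down]) (s' := [down, up, up, down, down])
            (t' := [up, down, down]) (.id [down])
            (.tensor (s := [down, up]) (t := []) (.cup down) (.id [up, down, down])))
          (.tensor (s := [down, up]) (t := []) (.cup down) (.id [down, down])))))

/-- A crossing of a strand that goes down from NW to SE with a strand that goes up from SW to NE:
`crossUp` turned by 90 degrees clockwise. -/
def crossRight (e : Sgn) : Tangle Crossing [down, up] [up, down] :=
  .comp (t := [down, up, up, down])
    (.tensor (s := [down, up]) (t := [down, up]) (s' := []) (t' := [up, down])
      (.id [down, up]) (.cap up))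
    (.comp (t := [down, up, up, down])
      (.tensor (s := [down]) (t := [down]) (s' := [up, up, down]) (t' := [up, up, down])
        (.id [down]) (.tensor (crossUp e) (.id [down])))
      (.tensor (s := [down, up]) (t := []) (.cup down) (.id [up, down])))

/-- A crossing of a strand that goes up from SE to NW with a strand that goes down from NE to SW:
`crossUp` turned by 90 degrees counterclockwise. -/
def crossLeft (e : Sgn) : Tangle Crossing [up, down] [down, up] :=
  .comp (t := [down, up, up, down])
    (.tensor (s := []) (t := [down, up]) (.cap down) (.id [up, down]))
    (.comp (t := [down, up, up, down])
      (.tensor (s := [down]) (t := [down]) (s' := [up, up, down]) (t' := [up, up, down])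
        (.id [down]) (.tensor (crossUp e) (.id [down])))
      (.tensor (s := [down, up]) (t := [down, up]) (s' := [up, down]) (t' := [])
        (.id [down, up]) (.cup up)))

/-- The two-crossing tangles denoted by the locks. In the vertical lock, the strand from NW dips
below the strand from SE, crosses it twice, and leaves at NE; both crossings have sign `e`.
The horizontal lock is a full twist of two antiparallel vertical strands. -/
def lockTangle : ∀ s t : List Dir, Lock s t → Tangle Crossing s t
  | _, _, .vert e =>
      .comp (t := [down, down, up, up])
        (.tensor (s := [down]) (t := [down]) (s' := [up]) (t' := [down, up, up]) (.id [down])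
          (.tensor (s := []) (t := [down, up]) (.cap down) (.id [up])))
        (.comp (t := [down, down, up, up])
          (.tensor (crossDown e) (crossUp e))
          (.tensor (s := [down]) (t := [down]) (s' := [down, up, up]) (t' := [up]) (.id [down])
            (.tensor (s := [down, up]) (t := []) (.cup down) (.id [up]))))
  | _, _, .horiz e => .comp (crossRight e) (crossLeft e)

/-- The link diagram of a lock diagram. -/
def LockDiagram.toLink (L : LockDiagram) : LinkDiagram := Tangle.subst lockTangle L

/-! ## The planar state sum of a lock diagram -/

/-- Planar tangles: no vertices. -/
abbrev Planar (s t : List Dir) : Type := Tangle NoVertex s t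

/-- The elementary arcs of a planar tangle diagram. -/
def Arc : {s t : List Dir} → Planar s t → Type
  | _, _, .id w => Fin w.length
  | _, _, .cap _ => Unit
  | _, _, .cup _ => Unit
  | _, _, .comp S T => Arc S ⊕ Arc T
  | _, _, .tensor S T => Arc S ⊕ Arc T

/-- `AtTop T i x`: the arc `x` of `T` ends at the top end number `i` (counted from `0`). -/
def AtTop : {s t : List Dir} → (T : Planar s t) → ℕ → Arc T → Prop
  | _, _, .id _ => fun i x => Fin.val x = i
  | _, _, .cap _ => fun _ _ => False
  | _, _, .cup _ => fun i _ => i < 2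
  | _, _, .comp S _ => fun i => Sum.elim (AtTop S i) (fun _ => False)
  | _, _, .tensor (s := s) S T => fun i =>
      Sum.elim (AtTop S i) (fun y => ∃ j, i = s.length + j ∧ AtTop T j y)

/-- `AtBot T i x`: the arc `x` of `T` ends at the bottom end number `i` (counted from `0`). -/
def AtBot : {s t : List Dir} → (T : Planar s t) → ℕ → Arc T → Prop
  | _, _, .id _ => fun i x => Fin.val x = i
  | _, _, .cap _ => fun i _ => i < 2
  | _, _, .cup _ => fun _ _ => False
  | _, _, .comp _ T => fun i => Sum.elim (fun _ => False) (AtBot T i)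
  | _, _, .tensor (t := t) S T => fun i =>
      Sum.elim (AtBot S i) (fun y => ∃ j, i = t.length + j ∧ AtBot T j y)

/-- Two elementary arcs are glued to each other at an interior end: the lower end of the first one
is the upper end of the second one. -/
def Glued : {s t : List Dir} → (T : Planar s t) → Arc T → Arc T → Prop
  | _, _, .id _ => fun _ _ => False
  | _, _, .cap _ => fun _ _ => False
  | _, _, .cup _ => fun _ _ => False
  | _, _, .comp S T =>
      Sum.elim (fun x => Sum.elim (Glued S x) (fun y => ∃ i, AtBot S i x ∧ AtTop T i y))
        (fun y => Sum.elim (fun _ => False) (Glued T y))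
  | _, _, .tensor S T =>
      Sum.elim (fun x => Sum.elim (Glued S x) (fun _ => False))
        (fun y => Sum.elim (fun _ => False) (Glued T y))

/-- The number of cycles of a closed planar diagram: the number of classes of elementary arcs under
the equivalence relation generated by gluing. -/
noncomputable def cycles (T : Closed NoVertex) : ℕ := Nat.card (Quot (Glued T))

/-- A planar tangle with the exponents `b`, `c` of its coefficient `φ ^ b * φ' ^ c`. -/
structure Resolution (s t : List Dir) where
  b : ℕ
  c : ℕ
  tangle : Planar s t

/-- The two planar resolutions of a lock: one with coefficient `1`, the other one with
coefficient `φ` for a positive and `φ'` for a negative lock. -/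
def lockResolutions : {s t : List Dir} → Lock s t → List (Resolution s t)
  | _, _, .vert .pos => [⟨0, 0, smoothH⟩, ⟨1, 0, smoothV⟩]
  | _, _, .vert .neg => [⟨0, 0, smoothH⟩, ⟨0, 1, smoothV⟩]
  | _, _, .horiz .pos => [⟨0, 0, smoothV⟩, ⟨1, 0, smoothH⟩]
  | _, _, .horiz .neg => [⟨0, 0, smoothV⟩, ⟨0, 1, smoothH⟩]

/-- The list of all `2 ^ v` planar resolutions of a lock tangle with `v` locks. -/
def resolutions : {s t : List Dir} → Tangle Lock s t → List (Resolution s t)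
  | _, _, .id w => [⟨0, 0, .id w⟩]
  | _, _, .cap a => [⟨0, 0, .cap a⟩]
  | _, _, .cup a => [⟨0, 0, .cup a⟩]
  | _, _, .vertex v => lockResolutions v
  | _, _, .comp S T => (resolutions S).flatMap fun x =>
      (resolutions T).map fun y => ⟨x.b + y.b, x.c + y.c, .comp x.tangle y.tangle⟩
  | _, _, .tensor S T => (resolutions S).flatMap fun x =>
      (resolutions T).map fun y => ⟨x.b + y.b, x.c + y.c, .tensor x.tangle y.tangle⟩

/-- The planar state sum `P = ∑ D ^ a * φ ^ b * φ' ^ c` of a lock diagram, where `a` is the number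
of cycles of the resolution. -/
noncomputable def planarP {R : Type*} [CommRing R] (D φ φ' : R) (L : LockDiagram) : R :=
  ((resolutions L).map fun x => D ^ cycles x.tangle * φ ^ x.b * φ' ^ x.c).sum

/-- The chain coefficient `Φ n`: it is `((1 + φ * D) ^ n - 1) / D` for `n ≥ 0`, and
`((1 + φ' * D) ^ k - 1) / D` for `n = -k < 0`, with the division carried out. -/
def chainCoeff {R : Type*} [CommRing R] (D φ φ' : R) : ℤ → R
  | .ofNat n => ∑ k ∈ Finset.range n, (n.choose (k + 1) : R) * φ ^ (k + 1) * D ^ k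
  | .negSucc n => ∑ k ∈ Finset.range (n + 1), ((n + 1).choose (k + 1) : R) * φ' ^ (k + 1) * D ^ k

/-! ## Double braids, twist knots and antiparallel torus links -/

/-- The sign of the locks in a chain of `n` locks, `n : ℤ`. -/
def sgnOf : ℤ → Sgn
  | .ofNat _ => .pos
  | .negSucc _ => .neg

/-- `k` horizontal locks of sign `e`, stacked vertically. -/
def stack (e : Sgn) : ℕ → Tangle Lock [down, up] [down, up]
  | 0 => smoothV
  | k + 1 => .comp (stack e k) (.vertex (.horiz e))

/-- `k` vertical locks of sign `e`, joined side by side. -/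
def row (e : Sgn) : ℕ → Tangle Lock [down, up] [down, up]
  | 0 => smoothH
  | k + 1 => sideBySide (row e k) (.vertex (.vert e))

/-- The vertical chain of `|n|` horizontal locks of the sign of `n`: an antiparallel braid with
`2 * |n|` crossings. -/
def verticalChain (n : ℤ) : Tangle Lock [down, up] [down, up] := stack (sgnOf n) n.natAbs

/-- The horizontal chain of `|n|` vertical locks of the sign of `n`. -/
def horizontalChain (n : ℤ) : Tangle Lock [down, up] [down, up] := row (sgnOf n) n.natAbs

/-- The lock diagram of the double braid `DB(2m, 2n)`: two orthogonal antiparallel chains with `m`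
and `n` locks. -/
def doubleBraid (m n : ℤ) : LockDiagram :=
  close (.comp (verticalChain m) (horizontalChain n))

/-- The lock diagram of the two-component antiparallel torus link `APT[2, 2n]`. -/
def aptLink (n : ℤ) : LockDiagram := close (verticalChain n)

/-- The twist knot `Tw_{2n} = DB(2, 2n)`. -/
def twist (n : ℤ) : LockDiagram := doubleBraid 1 n

/-- The twist knot `\overline{Tw}_{2n} = DB(-2, -2n)`, with the opposite lock element. -/
def twistBar (n : ℤ) : LockDiagram := doubleBraid (-1) (-n)

/-! ## The fundamental HOMFLY polynomial -/

section RT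

variable {K : Type*} [Field K]

/-- The entries `R^{ab}_{cd}` of the `R`-matrix of the fundamental representation of `sl_q(N)`
(`c, d` at the bottom, `a, b` at the top), and of its inverse. -/
def rMatrix {N : ℕ} (q : K) (e : Sgn) (a b c d : Fin N) : K :=
  match e with
  | .pos =>
      if a = b ∧ b = c ∧ c = d then q
      else if a = d ∧ b = c then 1
      else if a = c ∧ b = d ∧ c < d then q - q⁻¹
      else 0
  | .neg =>
      if a = b ∧ b = c ∧ c = d then q⁻¹
      else if a = d ∧ b = c then 1
      else if a = c ∧ b = d ∧ d < c then -(q - q⁻¹)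
      else 0

/-- Matrix entries of a crossing, with the labels at the top and at the bottom given as words. -/
def crossingWeight {N : ℕ} (q : K) : {s t : List Dir} → Crossing s t →
    List (Fin N) → List (Fin N) → K
  | _, _, .crossing e, [a, b], [c, d] => rMatrix q e a b c d
  | _, _, .crossing _, _, _ => 0

/-- The Reshetikhin-Turaev matrix of a tangle diagram in the fundamental representation of
`sl_q(N)`, in the vertical framing: the entry for the labels `x` at the top and `y` at the bottom.
With the labels numbered `0, …, N - 1`, the quantum trace has the weights `q ^ (2 i + 1 - N)`. -/
def rtMatrix (N : ℕ) (q : K) : {s t : List Dir} → Tangle Crossing s t →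
    List (Fin N) → List (Fin N) → K
  | _, _, .id _, x, y => if x = y then 1 else 0
  | _, _, .cap up, [], [i, j] => if i = j then 1 else 0
  | _, _, .cap down, [], [i, j] => if i = j then q ^ (-(2 * (i.val : ℤ) + 1 - N)) else 0
  | _, _, .cap _, _, _ => 0
  | _, _, .cup down, [i, j], [] => if i = j then 1 else 0
  | _, _, .cup up, [i, j], [] => if i = j then q ^ (2 * (i.val : ℤ) + 1 - N) else 0
  | _, _, .cup _, _, _ => 0
  | _, _, .vertex v, x, y => crossingWeight q v x y
  | _, _, .comp (t := t) S T, x, y =>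
      ∑ z : Fin t.length → Fin N,
        rtMatrix N q S x (List.ofFn z) * rtMatrix N q T (List.ofFn z) y
  | _, _, .tensor (s := s) (t := t) S T, x, y =>
      rtMatrix N q S (x.take s.length) (y.take t.length) *
        rtMatrix N q T (x.drop s.length) (y.drop t.length)

end RT

/-- The sign of a crossing, as a number. -/
def crossingSign : {s t : List Dir} → Crossing s t → ℤ
  | _, _, .crossing .pos => 1
  | _, _, .crossing .neg => -1

/-- The writhe number of a diagram. -/
def writhe : {s t : List Dir} → Tangle Crossing s t → ℤ
  | _, _, .id _ => 0
  | _, _, .cap _ => 0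
  | _, _, .cup _ => 0
  | _, _, .vertex v => crossingSign v
  | _, _, .comp S T => writhe S + writhe T
  | _, _, .tensor S T => writhe S + writhe T

/-- The `sl_q(N)` invariant of a link diagram in the topological framing,
`A ^ (-w)` times its Reshetikhin-Turaev value, with `A = q ^ N`. -/
def slInvariant {K : Type*} [Field K] (N : ℕ) (q : K) (L : LinkDiagram) : K :=
  (q ^ N) ^ (-writhe L) * rtMatrix N q L [] []

/-- The field `ℚ(q)`. -/
abbrev Kq : Type := RatFunc ℚ

open scoped LaurentPolynomial in
/-- Laurent polynomials in `A` over `ℚ(q)`. -/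
abbrev LaurentA : Type := Kq[T;T⁻¹]

/-- The unit `q ^ N` of `ℚ(q)`. -/
noncomputable def qPow (N : ℕ) : Kqˣ := (Units.mk0 (RatFunc.X : Kq) RatFunc.X_ne_zero) ^ N

/-- `H` is the fundamental HOMFLY polynomial of `L`, as a Laurent polynomial in `A` over `ℚ(q)`
(the unknot has the value `{A} / {q}`): for every `N ≥ 1`, the substitution `A = q ^ N` turns it
into the `sl_q(N)` invariant of `L`. There is at most one such `H`. -/
def IsHomfly (L : LinkDiagram) (H : LaurentA) : Prop :=
  ∀ N : ℕ, 1 ≤ N → LaurentPolynomial.eval₂ (RingHom.id Kq) (qPow N) H =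
    slInvariant N (RatFunc.X : Kq) L

instance : IsDomain LaurentA :=
  IsLocalization.isDomain_of_le_nonZeroDivisors (M := Submonoid.powers (Polynomial.X : Polynomial Kq))
    LaurentA (powers_le_nonZeroDivisors_of_noZeroDivisors Polynomial.X_ne_zero)

/-- The field `ℚ(q)(A)` of rational functions in `A` and `q`. -/
abbrev KAq : Type := FractionRing LaurentA

/-- The inclusion of Laurent polynomials in `A` into rational functions. -/
noncomputable def incl : LaurentA →+* KAq := algebraMap LaurentA KAq

/-- The variable `q`. -/
noncomputable def qv : KAq := incl (LaurentPolynomial.C RatFunc.X)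

/-- The variable `A`. -/
noncomputable def Av : KAq := incl (LaurentPolynomial.T 1)

/-- `{x} = x - x⁻¹`. -/
noncomputable def br (x : KAq) : KAq := x - x⁻¹

/-- The quantum dimension `D = {A} / {q}`. -/
noncomputable def Dv : KAq := br Av / br qv

/-- `φ = A {q}`. -/
noncomputable def phi : KAq := Av * br qv

/-- `φ' = -A⁻¹ {q}`, the coefficient of the opposite lock. -/
noncomputable def phiBar : KAq := -Av⁻¹ * br qv

/-- `F` is the cyclotomic function of the knot `L`: the Laurent polynomial in the differential
expansion `H = D * (1 + {A q} {A / q} F)`. -/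
def IsCyclotomicKnot (L : LinkDiagram) (F : LaurentA) : Prop :=
  ∃ H : LaurentA, IsHomfly L H ∧
    incl H = Dv * (1 + br (Av * qv) * br (Av / qv) * incl F)

/-- `F` is the cyclotomic function of the two-component link `L`: the Laurent polynomial in the
differential expansion `H = D ^ 2 * (1 + {A q} {A / q} / {A} * F)`. -/
def IsCyclotomicLink (L : LinkDiagram) (F : LaurentA) : Prop :=
  ∃ H : LaurentA, IsHomfly L H ∧
    incl H = Dv ^ 2 * (1 + br (Av * qv) * br (Av / qv) / br Av * incl F)

end BipartiteLinks

open BipartiteLinks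

/-! One state sum carries the whole argument. `stateSum` evaluates a tangle diagram with labels in
`Fin N`, arbitrary vertex weights and arc weights `κ`, `κ'`. If `κ i * κ' i = 1` and both weights
sum to `D`, the antiparallel tangles built from locks act as `α • smoothV + β • smoothH` (`IsComb`):
stacking and juxtaposing obey planar calculus with loop value `D`, and closing gives `α D² + β D`. A
vertical chain has coefficients `(1, Φ)`, a horizontal one `(Φ, 1)`, and the formula for the double
braid follows (`stateSum_doubleBraid`).

The formula is used twice. With `κ = κ' = 1`, the state sum of a closed planar diagram counts its
colourings, of which there are `N ^ cycles`. This gives the planar state sum at `D = N` for every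
`N`, and a polynomial identity at infinitely many points is an identity (`planarP_doubleBraid`).
With the weights of the quantum trace, `D` is the quantum dimension, and the Reshetikhin-Turaev
matrix of a lock is exactly the weighted sum of its two resolutions, with `φ = A{q}`, `φ' = -A⁻¹{q}`
at `A = q ^ N` (`stateSum_lockTangle`); the content is a telescoping sum (`kink_vert`,
`kink_horiz`).

Finally `1 + φ D = A²` and `1 + φ' D = A⁻²`, so `Φ_n D = A ^ (2n) - 1` for every integer `n`;
together with `{Aq}{A/q} = {A}² - {q}²` this yields the closed forms. They are Laurent polynomials
because `{A}` divides `A ^ (-2n) - 1`, and they are unique because a Laurent polynomial vanishing at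
all `A = q ^ N` is zero (`eq_zero_of_evalAt`). -/

namespace BipartiteLinks
open Dir Tangle

/-! ### State sums with arbitrary weights. -/

section StateSum

variable {R : Type*} [CommRing R] {N : ℕ} {V W : List Dir → List Dir → Type}

/-- Sum over all words in `Fin N` of the length of `l`. -/
def wsum : List Dir → (List (Fin N) → R) → R
  | [], f => f []
  | _ :: l, f => ∑ a, wsum l fun w => f (a :: w)

/-- On an explicit word `wsum` unfolds to iterated sums over single labels, so that small tangles
can be evaluated by `simp`; the sum over functions is better for general summation lemmas. -/
theorem sum_ofFn_eq_wsum (l : List Dir) (f : List (Fin N) → R) :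
    ∑ z : Fin l.length → Fin N, f (List.ofFn z) = wsum l f := by
  induction l generalizing f with
  | nil => simp [wsum]
  | cons d l ih =>
    have e := (Fin.consEquiv fun _ : Fin (l.length + 1) => Fin N).sum_comp
      (fun z => f (List.ofFn z))
    refine e.symm.trans ?_
    rw [wsum, Fintype.sum_prod_type]
    refine Finset.sum_congr rfl fun a _ => ?_
    rw [← ih]
    refine Finset.sum_congr rfl fun z _ => ?_
    simp [Fin.consEquiv, List.ofFn_succ]

/-- The matrix of a cap: weight `1` if the left leg goes up and `κ' i` if it goes down. -/
def capWeight (κ' : Fin N → R) : Dir → List (Fin N) → List (Fin N) → R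
  | up, [], [i, j] => if i = j then 1 else 0
  | down, [], [i, j] => if i = j then κ' i else 0
  | _, _, _ => 0

/-- The matrix of a cup: weight `1` if the left leg goes down and `κ i` if it goes up. -/
def cupWeight (κ : Fin N → R) : Dir → List (Fin N) → List (Fin N) → R
  | down, [i, j], [] => if i = j then 1 else 0
  | up, [i, j], [] => if i = j then κ i else 0
  | _, _, _ => 0

/-- The state sum of a tangle diagram with weights `v` of the vertices and `κ`, `κ'` of the arcs. -/
def stateSum (κ κ' : Fin N → R)
    (v : ∀ s t : List Dir, V s t → List (Fin N) → List (Fin N) → R) :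
    {s t : List Dir} → Tangle V s t → List (Fin N) → List (Fin N) → R
  | _, _, .id _, x, y => if x = y then 1 else 0
  | _, _, .cap a, x, y => capWeight κ' a x y
  | _, _, .cup a, x, y => cupWeight κ a x y
  | s, t, .vertex c, x, y => v s t c x y
  | _, _, .comp (t := t) S T, x, y => wsum t fun z => stateSum κ κ' v S x z * stateSum κ κ' v T z y
  | _, _, .tensor (s := s) (t := t) S T, x, y =>
      stateSum κ κ' v S (x.take s.length) (y.take t.length) *
        stateSum κ κ' v T (x.drop s.length) (y.drop t.length)

variable (κ κ' : Fin N → R)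

theorem wsum_congr {l : List Dir} {f g : List (Fin N) → R}
    (h : ∀ w, w.length = l.length → f w = g w) : wsum l f = wsum l g := by
  rw [← sum_ofFn_eq_wsum, ← sum_ofFn_eq_wsum]
  exact Finset.sum_congr rfl fun z _ => h _ (by simp)

/-- The state sum is local, so a link diagram obtained from locks can be evaluated with the locks as
vertices. -/
theorem stateSum_subst (v : ∀ s t : List Dir, W s t → List (Fin N) → List (Fin N) → R)
    (f : ∀ s t : List Dir, V s t → Tangle W s t) {s t : List Dir} (T : Tangle V s t) :
    stateSum κ κ' v (T.subst f) = stateSum κ κ' (fun s t c => stateSum κ κ' v (f s t c)) T := by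
  induction T with
  | id w => rfl
  | cap a => rfl
  | cup a => rfl
  | vertex c => rfl
  | comp S T hS hT => funext x y; simp only [Tangle.subst, stateSum, hS, hT]
  | tensor S T hS hT => funext x y; simp only [Tangle.subst, stateSum, hS, hT]

/-- Agreement is required only on words of the right length. This matters: on words of a wrong
length `id` still has entries `1`, so a lock and its planar resolutions may differ there. -/
theorem stateSum_congr {v v' : ∀ s t : List Dir, V s t → List (Fin N) → List (Fin N) → R}
    (h : ∀ s t c x y, x.length = s.length → y.length = t.length → v s t c x y = v' s t c x y)
    {s t : List Dir} (T : Tangle V s t) (x y : List (Fin N))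
    (hx : x.length = s.length) (hy : y.length = t.length) :
    stateSum κ κ' v T x y = stateSum κ κ' v' T x y := by
  induction T generalizing x y with
  | id w => rfl
  | cap a => rfl
  | cup a => rfl
  | vertex c => exact h _ _ c x y hx hy
  | comp S T hS hT =>
    exact wsum_congr fun w hw => by rw [hS _ _ hx hw, hT _ _ hw hy]
  | tensor S T hS hT =>
    simp only [List.length_append] at hx hy
    simp only [stateSum]
    rw [hS _ _ (by simp [hx]) (by simp [hy]), hT _ _ (by simp [hx]) (by simp [hy])]

theorem rtMatrix_eq_stateSum {K : Type*} [Field K] (q : K) {s t : List Dir}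
    (T : Tangle Crossing s t) :
    rtMatrix N q T = stateSum (fun i : Fin N => q ^ (2 * (i.val : ℤ) + 1 - N))
      (fun i => q ^ (-(2 * (i.val : ℤ) + 1 - N))) (fun _ _ c => crossingWeight q c) T := by
  induction T with
  | id w => rfl
  | cap a =>
    funext x y
    cases a <;> rcases x with _ | ⟨_, x⟩ <;> rcases y with _ | ⟨i, _ | ⟨j, _ | ⟨k, y⟩⟩⟩ <;> rfl
  | cup a =>
    funext x y
    cases a <;> rcases y with _ | ⟨_, y⟩ <;> rcases x with _ | ⟨i, _ | ⟨j, _ | ⟨k, x⟩⟩⟩ <;> rfl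
  | vertex c => rfl
  | comp S T hS hT => funext x y; simp only [rtMatrix, stateSum, hS, hT, ← sum_ofFn_eq_wsum]
  | tensor S T hS hT => funext x y; simp only [rtMatrix, stateSum, hS, hT]

/-! ### Expansion into planar resolutions -/

/-- The vertex weights of planar diagrams. -/
def noWeight (s t : List Dir) (c : NoVertex s t) : List (Fin N) → List (Fin N) → R := nomatch c

/-- The state sum of the planar resolutions in a list, with coefficients `φ ^ b * φ' ^ c`. -/
def resolutionSum (φ φ' : R) {s t : List Dir} (l : List (Resolution s t)) (x y : List (Fin N)) : R :=
  (l.map fun r => stateSum κ κ' noWeight r.tangle x y * φ ^ r.b * φ' ^ r.c).sum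

/-- The weight of a lock: the weighted sum of its planar resolutions. -/
def lockWeight (φ φ' : R) (s t : List Dir) (c : Lock s t) : List (Fin N) → List (Fin N) → R :=
  resolutionSum κ κ' φ φ' (lockResolutions c)

theorem wsum_add (l : List Dir) (f g : List (Fin N) → R) :
    wsum l (fun w => f w + g w) = wsum l f + wsum l g := by
  simp only [← sum_ofFn_eq_wsum, Finset.sum_add_distrib]

theorem wsum_mul_left (l : List Dir) (r : R) (f : List (Fin N) → R) :
    wsum l (fun w => r * f w) = r * wsum l f := by
  simp only [← sum_ofFn_eq_wsum, Finset.mul_sum]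

theorem wsum_list_sum {ι : Type*} (l : List Dir) (L : List ι) (f : ι → List (Fin N) → R) :
    wsum l (fun w => (L.map fun i => f i w).sum) = (L.map fun i => wsum l (f i)).sum := by
  induction L with
  | nil => simp [← sum_ofFn_eq_wsum]
  | cons i L ih => simp [wsum_add, ih]

theorem list_sum_map_mul_sum_map {ι ι' : Type*} (L : List ι) (L' : List ι') (f : ι → R)
    (g : ι' → R) :
    (L.map f).sum * (L'.map g).sum = (L.map fun i => (L'.map fun j => f i * g j).sum).sum := by
  rw [← List.sum_map_mul_right]
  simp only [List.sum_map_mul_left]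

theorem sum_map_flatMap {ι ι' : Type*} (L : List ι) (f : ι → List ι') (g : ι' → R) :
    ((L.flatMap f).map g).sum = (L.map fun i => ((f i).map g).sum).sum := by
  induction L with
  | nil => simp
  | cons i L ih => simp [ih]

/-- Multilinearity in the vertex weights: expanding the product over all locks produces one term for
each choice of resolutions. -/
theorem stateSum_lockWeight (φ φ' : R) {s t : List Dir} (T : Tangle Lock s t) :
    stateSum κ κ' (lockWeight κ κ' φ φ') T = resolutionSum κ κ' φ φ' (resolutions T) := by
  induction T with
  | id w => funext x y; simp [resolutions, resolutionSum, stateSum]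
  | cap a => funext x y; simp [resolutions, resolutionSum, stateSum]
  | cup a => funext x y; simp [resolutions, resolutionSum, stateSum]
  | vertex c => rfl
  | comp S T hS hT =>
    funext x y
    simp only [stateSum, hS, hT, resolutionSum, resolutions, sum_map_flatMap, List.map_map,
      list_sum_map_mul_sum_map, wsum_list_sum, Function.comp_def]
    refine congrArg List.sum (List.map_congr_left fun r _ => congrArg List.sum
      (List.map_congr_left fun r' _ => ?_))
    rw [mul_assoc, mul_comm, ← wsum_mul_left]
    congr 1; funext w
    ring
  | tensor S T hS hT =>
    funext x y
    simp only [stateSum, hS, hT, resolutionSum, resolutions, sum_map_flatMap, List.map_map,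
      list_sum_map_mul_sum_map, Function.comp_def]
    refine congrArg List.sum (List.map_congr_left fun r _ => congrArg List.sum
      (List.map_congr_left fun r' _ => ?_))
    ring

/-! ### Antiparallel two-strand tangles -/

/-- The matrix of `T` is the combination `α • smoothV + β • smoothH`. -/
def IsComb (v : ∀ s t : List Dir, V s t → List (Fin N) → List (Fin N) → R)
    (T : Tangle V [down, up] [down, up]) (α β : R) : Prop :=
  ∀ a b c d, stateSum κ κ' v T [a, b] [c, d] =
    α * (if a = c then if b = d then 1 else 0 else 0) +
      β * (if a = b then if c = d then κ' c else 0 else 0)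

variable {κ κ'} {v : ∀ s t : List Dir, V s t → List (Fin N) → List (Fin N) → R}

theorem isComb_smoothV : IsComb κ κ' v smoothV 1 0 := by
  intro a b c d
  simp [smoothV, stateSum, ite_and]

theorem isComb_smoothH : IsComb κ κ' v smoothH 0 1 := by
  intro a b c d
  simp only [smoothH, stateSum, wsum, capWeight, cupWeight]
  split_ifs <;> simp

variable {D : R}

/-- Only `smoothH` over `smoothH` closes a loop. That loop consists of a `cup down` of weight `1`
and a `cap down`, hence has value `∑ κ'`. -/
theorem IsComb.comp (hD' : ∑ i, κ' i = D) {S T : Tangle V [down, up] [down, up]} {α β γ δ : R}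
    (hS : IsComb κ κ' v S α β) (hT : IsComb κ κ' v T γ δ) :
    IsComb κ κ' v (.comp S T) (α * γ) (α * δ + β * γ + β * δ * D) := by
  intro a b c d
  subst hD'
  simp only [stateSum, wsum, hS a b, hT _ _ c d, mul_add, add_mul, Finset.sum_add_distrib]
  simp only [mul_ite, ite_mul, mul_zero, zero_mul, mul_one, Finset.sum_ite_eq, Finset.sum_ite_eq',
    Finset.mem_univ, if_true, Finset.sum_ite_irrel, Finset.sum_const_zero, Finset.mul_sum,
    Finset.sum_mul, eq_comm (a := b)]
  have : ∑ x, β * κ' x * (δ * κ' c) = ∑ x, β * δ * κ' x * κ' c :=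
    Finset.sum_congr rfl fun _ _ => by ring
  rw [this]
  split_ifs <;> ring

/-- Here the loop arises from `smoothV` beside `smoothV`, and it has value `∑ κ`. Where a `cap down`
is straightened against a `cup up`, the weights cancel by `κ i * κ' i = 1`. -/
theorem IsComb.sideBySide (hD : ∑ i, κ i = D) (h : ∀ i, κ i * κ' i = 1)
    {S T : Tangle V [down, up] [down, up]} {α β γ δ : R}
    (hS : IsComb κ κ' v S α β) (hT : IsComb κ κ' v T γ δ) :
    IsComb κ κ' v (sideBySide S T) (α * γ * D + α * δ + β * γ) (β * δ) := by
  intro a b c d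
  subst hD
  simp [Tangle.sideBySide, stateSum, wsum, capWeight, cupWeight]
  simp only [hS a _ c, hT _ b _ d, mul_add, add_mul, Finset.sum_add_distrib]
  simp only [mul_ite, ite_mul, mul_zero, zero_mul, mul_one, Finset.sum_ite_eq, Finset.sum_ite_eq',
    Finset.mem_univ, if_true, Finset.sum_ite_irrel, Finset.sum_const_zero, Finset.mul_sum]
  have h₁ := h c
  have h₂ := h d
  have e₁ : β * κ' c * γ * κ c = β * γ := by linear_combination β * γ * h₁
  have e₂ : α * (δ * κ' d) * κ d = α * δ := by linear_combination α * δ * h₂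
  have e₃ : β * κ' c * (δ * κ' d) * κ d = β * δ * κ' c := by
    linear_combination β * κ' c * δ * h₂
  by_cases hac : a = c
  · subst hac
    simp only [e₁, e₂, e₃, if_true]
    split_ifs <;> ring
  · simp [hac, Ne.symm hac, e₃]

/-- This lemma and the next four peel off one horizontal layer at a time, so that a closure is
evaluated without expanding all of its intermediate words at once. -/
theorem stateSum_comp_capLayer {t : List Dir} (T : Tangle V [down, up, down, up] t)
    (a b : Fin N) (y : List (Fin N)) :
    stateSum κ κ' v (.comp (.tensor (s := [down]) (t := [down]) (s' := [up]) (t' := [up, down, up])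
      (.id [down]) (.tensor (s := []) (t := [up, down]) (.cap up) (.id [up]))) T) [a, b] y =
      ∑ i, stateSum κ κ' v T [a, i, i, b] y := by
  simp [stateSum, wsum, capWeight]

theorem stateSum_comp_cupLayer {t : List Dir} (T : Tangle V [down, up] t)
    (a b c d : Fin N) (y : List (Fin N)) :
    stateSum κ κ' v (.comp (.tensor (s := [down]) (t := [down]) (s' := [up, down, up]) (t' := [up])
      (.id [down]) (.tensor (s := [up, down]) (t := []) (.cup up) (.id [up]))) T) [a, b, c, d] y =
      if b = c then κ b * stateSum κ κ' v T [a, d] y else 0 := by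
  simp [stateSum, wsum, cupWeight]

theorem stateSum_comp_cupLayer_cup (a b c d : Fin N) :
    stateSum κ κ' v (.comp (t := [down, up])
      (.tensor (s := [down]) (t := [down]) (s' := [up, down, up]) (t' := [up])
      (.id [down]) (.tensor (s := [up, down]) (t := []) (.cup up) (.id [up]))) (.cup down))
        [a, b, c, d] [] = if b = c then if a = d then κ b else 0 else 0 := by
  refine (stateSum_comp_cupLayer _ _ _ _ _ _).trans ?_
  simp [stateSum, cupWeight]

theorem stateSum_comp_cap_down {t : List Dir} (T : Tangle V [down, up] t) (y : List (Fin N)) :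
    stateSum κ κ' v (.comp (t := [down, up]) (.cap down) T) [] y = ∑ i, κ' i * stateSum κ κ' v T [i, i] y := by
  simp only [stateSum, wsum, capWeight]
  simp

theorem stateSum_comp_tensor_id {t : List Dir} (S : Tangle V [down, up] [down, up])
    (T : Tangle V [down, up, down, up] t) (a b c d : Fin N) (y : List (Fin N)) :
    stateSum κ κ' v (.comp (t := [down, up, down, up]) (.tensor S (.id [down, up])) T) [a, b, c, d] y =
      ∑ i, ∑ j, stateSum κ κ' v S [a, b] [i, j] * stateSum κ κ' v T [i, j, c, d] y := by
  simp [stateSum, wsum, ite_and]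

theorem IsComb.close (hD : ∑ i, κ i = D) (hD' : ∑ i, κ' i = D) (h : ∀ i, κ i * κ' i = 1)
    {T : Tangle V [down, up] [down, up]} {α β : R} (hT : IsComb κ κ' v T α β) :
    stateSum κ κ' v (close T) [] [] = α * D ^ 2 + β * D := by
  refine (stateSum_comp_cap_down _ _).trans ?_
  simp only [stateSum_comp_capLayer, stateSum_comp_tensor_id, stateSum_comp_cupLayer_cup,
    hT _ _ _ _, add_mul, Finset.sum_add_distrib]
  simp
  -- The two nested circles of `smoothV` contribute `∑ κ'` and `∑ κ`. The single circle of `smoothH`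
  -- carries `κ' x * κ' x * κ x = κ' x`.
  have e : ∀ x, κ' x * (∑ y, α * κ y + β * κ' x * κ x) = α * D * κ' x + β * κ' x := fun x => by
    rw [← Finset.mul_sum, hD]
    linear_combination β * κ' x * h x
  rw [Finset.sum_congr rfl fun x _ => e x, Finset.sum_add_distrib, ← Finset.mul_sum,
    ← Finset.mul_sum, hD']
  ring

/-- The coefficient of the planar resolution of a lock of sign `e` with a non-trivial coefficient. -/
def lockCoeff (φ φ' : R) : Sgn → R
  | .pos => φ
  | .neg => φ'

variable (φ φ' : R)

theorem isComb_horiz (e : Sgn) :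
    IsComb κ κ' (lockWeight κ κ' φ φ') (.vertex (.horiz e)) 1 (lockCoeff φ φ' e) := by
  intro a b c d
  have hV := isComb_smoothV (κ := κ) (κ' := κ') (v := noWeight) a b c d
  have hH := isComb_smoothH (κ := κ) (κ' := κ') (v := noWeight) a b c d
  cases e <;>
    simp only [stateSum, lockWeight, lockResolutions, resolutionSum, List.map, List.sum_cons,
      List.sum_nil, hV, hH, lockCoeff] <;> ring

theorem isComb_vert (e : Sgn) :
    IsComb κ κ' (lockWeight κ κ' φ φ') (.vertex (.vert e)) (lockCoeff φ φ' e) 1 := by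
  intro a b c d
  have hV := isComb_smoothV (κ := κ) (κ' := κ') (v := noWeight) a b c d
  have hH := isComb_smoothH (κ := κ) (κ' := κ') (v := noWeight) a b c d
  cases e <;>
    simp only [stateSum, lockWeight, lockResolutions, resolutionSum, List.map, List.sum_cons,
      List.sum_nil, hV, hH, lockCoeff] <;> ring

theorem chainCoeff_natCast (D φ φ' : R) (k : ℕ) :
    chainCoeff D φ φ' k =
      ∑ j ∈ Finset.range k, (k.choose (j + 1) : R) * φ ^ (j + 1) * D ^ j := rfl

/-- Pascal's rule. It is the recursion of `((1 + φ D) ^ k - 1) / D` with the division carried out,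
and matches the effect of adding one lock to a chain. -/
theorem chainCoeff_natCast_succ (D φ φ' : R) (k : ℕ) :
    chainCoeff D φ φ' ((k + 1 : ℕ) : ℤ) =
      φ + chainCoeff D φ φ' k + chainCoeff D φ φ' k * φ * D := by
  rw [chainCoeff_natCast, chainCoeff_natCast]
  simp only [Nat.choose_succ_succ, Nat.cast_add, add_mul, Finset.sum_add_distrib]
  rw [Finset.sum_range_succ', Finset.sum_range_succ (fun x => (k.choose (x + 1) : R) * _ * _) k,
    Finset.sum_mul, Finset.sum_mul]
  simp only [Nat.choose_succ_self]
  have : ∀ j ∈ Finset.range k, (k.choose (j + 1) : R) * φ ^ (j + 1 + 1) * D ^ (j + 1) =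
      (k.choose (j + 1) : R) * φ ^ (j + 1) * D ^ j * φ * D := fun j _ => by ring
  rw [Finset.sum_congr rfl this]
  simp
  ring

theorem chainCoeff_neg_natCast (D φ φ' : R) (k : ℕ) :
    chainCoeff D φ φ' (-k) = chainCoeff D φ' φ k := by
  cases k with
  | zero => rfl
  | succ k => rfl

/-- The argument `0` of `chainCoeff` is a dummy: for a natural index only the first coefficient
enters, and it is chosen by the sign `e`. -/
theorem isComb_stack (hD' : ∑ i, κ' i = D) (e : Sgn) (k : ℕ) :
    IsComb κ κ' (lockWeight κ κ' φ φ') (stack e k) 1 (chainCoeff D (lockCoeff φ φ' e) 0 k) := by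
  induction k with
  | zero => exact isComb_smoothV
  | succ k ih =>
    have := ih.comp hD' (isComb_horiz φ φ' e)
    rw [one_mul, one_mul, mul_one] at this
    rw [chainCoeff_natCast_succ]
    exact this

theorem isComb_row (hD : ∑ i, κ i = D) (h : ∀ i, κ i * κ' i = 1) (e : Sgn) (k : ℕ) :
    IsComb κ κ' (lockWeight κ κ' φ φ') (row e k) (chainCoeff D (lockCoeff φ φ' e) 0 k) 1 := by
  induction k with
  | zero => exact isComb_smoothH
  | succ k ih =>
    have := ih.sideBySide hD h (isComb_vert φ φ' e)
    rw [one_mul, mul_one, one_mul] at this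
    rw [chainCoeff_natCast_succ, add_comm (lockCoeff φ φ' e), add_right_comm, add_comm _ (_ * _ * D)]
    exact this

theorem chainCoeff_eq (D : R) (n : ℤ) :
    chainCoeff D (lockCoeff φ φ' (sgnOf n)) 0 n.natAbs = chainCoeff D φ φ' n := by
  cases n <;> rfl

theorem isComb_verticalChain (hD' : ∑ i, κ' i = D) (n : ℤ) :
    IsComb κ κ' (lockWeight κ κ' φ φ') (verticalChain n) 1 (chainCoeff D φ φ' n) := by
  rw [← chainCoeff_eq]
  exact isComb_stack φ φ' hD' _ _

theorem isComb_horizontalChain (hD : ∑ i, κ i = D) (h : ∀ i, κ i * κ' i = 1) (n : ℤ) :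
    IsComb κ κ' (lockWeight κ κ' φ φ') (horizontalChain n) (chainCoeff D φ φ' n) 1 := by
  rw [← chainCoeff_eq]
  exact isComb_row φ φ' hD h _ _

theorem stateSum_aptLink (hD : ∑ i, κ i = D) (hD' : ∑ i, κ' i = D) (h : ∀ i, κ i * κ' i = 1)
    (n : ℤ) :
    stateSum κ κ' (lockWeight κ κ' φ φ') (aptLink n) [] [] =
      D ^ 2 + chainCoeff D φ φ' n * D := by
  rw [aptLink, (isComb_verticalChain φ φ' hD' n).close hD hD' h, one_mul]

/-- Stacking `(1, Φ_m)` on `(Φ_n, 1)` gives `(Φ_n, 1 + Φ_m Φ_n + Φ_m D)`, which is then closed. -/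
theorem stateSum_doubleBraid (hD : ∑ i, κ i = D) (hD' : ∑ i, κ' i = D)
    (h : ∀ i, κ i * κ' i = 1) (m n : ℤ) :
    stateSum κ κ' (lockWeight κ κ' φ φ') (doubleBraid m n) [] [] =
      D + (chainCoeff D φ φ' n + chainCoeff D φ φ' m) * D ^ 2 +
          chainCoeff D φ φ' n * chainCoeff D φ φ' m * D := by
  rw [doubleBraid, ((isComb_verticalChain φ φ' hD' m).comp hD'
    (isComb_horizontalChain φ φ' hD h n)).close hD hD' h]
  ring

end StateSum


/-! ### Counting cycles by colourings -/

instance arcFintype : {s t : List Dir} → (T : Planar s t) → Fintype (Arc T)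
  | _, _, .id w => inferInstanceAs (Fintype (Fin w.length))
  | _, _, .cap _ => inferInstanceAs (Fintype Unit)
  | _, _, .cup _ => inferInstanceAs (Fintype Unit)
  | _, _, .comp S T =>
    letI := arcFintype S
    letI := arcFintype T
    inferInstanceAs (Fintype (Arc S ⊕ Arc T))
  | _, _, .tensor S T =>
    letI := arcFintype S
    letI := arcFintype T
    inferInstanceAs (Fintype (Arc S ⊕ Arc T))

theorem atTop_lt {s t : List Dir} (T : Planar s t) {i : ℕ} {x : Arc T} (h : AtTop T i x) :
    i < s.length := by
  induction T generalizing i with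
  | id w => cases h; exact x.isLt
  | cap a => cases h
  | cup a => exact h
  | vertex c => cases c
  | comp S T hS hT =>
    rcases x with x | x
    · exact hS h
    · cases h
  | tensor S T hS hT =>
    rw [List.length_append]
    rcases x with x | x
    · exact Nat.lt_add_right _ (hS h)
    · obtain ⟨j, rfl, hj⟩ := h
      exact Nat.add_lt_add_left (hT hj) _

theorem atBot_lt {s t : List Dir} (T : Planar s t) {i : ℕ} {x : Arc T} (h : AtBot T i x) :
    i < t.length := by
  induction T generalizing i with
  | id w => cases h; exact x.isLt
  | cap a => exact h
  | cup a => cases h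
  | vertex c => cases c
  | comp S T hS hT =>
    rcases x with x | x
    · cases h
    · exact hT h
  | tensor S T hS hT =>
    rw [List.length_append]
    rcases x with x | x
    · exact Nat.lt_add_right _ (hS h)
    · obtain ⟨j, rfl, hj⟩ := h
      exact Nat.add_lt_add_left (hT hj) _

/-- This makes the word on a middle level of a composition a function of the colouring of the upper
factor. -/
theorem existsUnique_atBot {s t : List Dir} (T : Planar s t) {i : ℕ} (h : i < t.length) :
    ∃! x, AtBot T i x := by
  induction T generalizing i with
  | id w => exact ⟨⟨i, h⟩, rfl, fun y hy => Fin.ext hy⟩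
  | cap a => exact ⟨(), h, fun _ _ => rfl⟩
  | cup a => cases h
  | vertex c => cases c
  | comp S T hS hT =>
    obtain ⟨x, hx, ux⟩ := hT h
    refine ⟨Sum.inr x, hx, ?_⟩
    rintro (y | y) hy
    · cases hy
    · exact congrArg Sum.inr (ux y hy)
  | @tensor s t s' t' S T hS hT =>
    rw [List.length_append] at h
    by_cases hi : i < t.length
    · obtain ⟨x, hx, ux⟩ := hS hi
      refine ⟨Sum.inl x, hx, ?_⟩
      rintro (y | y) hy
      · exact congrArg Sum.inl (ux y hy)
      · obtain ⟨j, rfl, _⟩ := hy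
        omega
    · obtain ⟨j, rfl⟩ := Nat.exists_eq_add_of_le (not_lt.1 hi)
      obtain ⟨x, hx, ux⟩ := hT (Nat.lt_of_add_lt_add_left h)
      refine ⟨Sum.inr x, ⟨j, rfl, hx⟩, ?_⟩
      rintro (y | y) hy
      · exact absurd (atBot_lt S hy) hi
      · obtain ⟨k, hk, hy⟩ := hy
        obtain rfl := Nat.add_left_cancel hk
        exact congrArg Sum.inr (ux y hy)

/-- The colouring `f` of the arcs is constant along the strands and restricts to the words `x` and
`y` on the ends. -/
def Colours {N : ℕ} {s t : List Dir} (T : Planar s t) (x y : List (Fin N))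
    (f : Arc T → Fin N) : Prop :=
  (∀ a b, Glued T a b → f a = f b) ∧ (∀ i a, AtTop T i a → x[i]? = some (f a)) ∧
    ∀ i a, AtBot T i a → y[i]? = some (f a)

open Classical in
/-- The number of colourings of a planar tangle with given colours of the ends. -/
noncomputable def colourings (R : Type*) [CommRing R] {N : ℕ} {s t : List Dir} (T : Planar s t)
    (x y : List (Fin N)) : R :=
  ∑ f : Arc T → Fin N, if Colours T x y f then 1 else 0

section

variable {R : Type*} [CommRing R] {N : ℕ}

theorem colours_comp {s t u : List Dir} (S : Planar s t) (T : Planar t u) (x y : List (Fin N))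
    (f : Arc S → Fin N) (g : Arc T → Fin N) :
    Colours (.comp S T) x y (Sum.elim f g) ↔
      ∃ z : Fin t.length → Fin N, Colours S x (List.ofFn z) f ∧ Colours T (List.ofFn z) y g := by
  constructor
  · rintro ⟨hG, hx, hy⟩
    -- The middle word is read off `S`: `p i` is its arc at the bottom end `i`.
    choose p hp _ using fun i : Fin t.length => existsUnique_atBot S i.isLt
    refine ⟨fun i => f (p i), ⟨fun a b h => hG (.inl a) (.inl b) h,
      fun i a h => hx i (.inl a) h, fun i a h => ?_⟩, fun a b h => hG (.inr a) (.inr b) h,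
      fun i a h => ?_, fun i a h => hy i (.inr a) h⟩
    · have hi := atBot_lt S h
      rw [List.getElem?_ofFn, dif_pos hi]
      exact congrArg (fun a => some (f a)) ((existsUnique_atBot S hi).unique (hp ⟨i, hi⟩) h)
    · have hi := atTop_lt T h
      rw [List.getElem?_ofFn, dif_pos hi]
      exact congrArg some (hG (.inl (p ⟨i, hi⟩)) (.inr a) ⟨i, hp ⟨i, hi⟩, h⟩)
  · rintro ⟨z, ⟨hS, hx, hz⟩, hT, hz', hy⟩
    refine ⟨?_, ?_, ?_⟩
    · rintro (a | a) (b | b) h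
      · exact hS a b h
      · obtain ⟨i, ha, hb⟩ := h
        exact Option.some.inj ((hz i a ha).symm.trans (hz' i b hb))
      · cases h
      · exact hT a b h
    · rintro i (a | a) h
      · exact hx i a h
      · cases h
    · rintro i (a | a) h
      · cases h
      · exact hy i a h

theorem colours_bot_unique {s t : List Dir} (S : Planar s t) {x : List (Fin N)}
    {f : Arc S → Fin N} {z w : Fin t.length → Fin N} (hz : Colours S x (List.ofFn z) f)
    (hw : Colours S x (List.ofFn w) f) : z = w := by
  funext i
  obtain ⟨a, ha, -⟩ := existsUnique_atBot S i.isLt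
  have := (hz.2.2 i a ha).trans (hw.2.2 i a ha).symm
  simpa using this

open Classical in
theorem colourings_comp {s t u : List Dir} (S : Planar s t) (T : Planar t u)
    (x y : List (Fin N)) :
    colourings R (.comp S T) x y = wsum t fun z => colourings R S x z * colourings R T z y := by
  rw [← sum_ofFn_eq_wsum]
  have e : colourings R (.comp S T) x y = ∑ f : Arc S → Fin N, ∑ g : Arc T → Fin N,
      if Colours (.comp S T) x y (Sum.elim f g) then 1 else 0 := by
    let e : (Arc S → Fin N) × (Arc T → Fin N) ≃ (Arc (.comp S T) → Fin N) :=
      (Equiv.sumArrowEquivProdArrow (Arc S) (Arc T) (Fin N)).symm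
    unfold colourings
    rw [← e.sum_comp, Fintype.sum_prod_type]
    rfl
  rw [e]
  simp only [colourings, Finset.sum_mul_sum]
  -- With the sum over middle words innermost, each pair of colourings admits at most one of them,
  -- and admits one exactly when the pair colours the composition.
  rw [Finset.sum_comm (γ := Fin t.length → Fin N)]
  refine Finset.sum_congr rfl fun f _ => ?_
  rw [Finset.sum_comm]
  refine Finset.sum_congr rfl fun g _ => ?_
  simp only [colours_comp, ite_zero_mul_ite_zero, mul_one]
  by_cases h : ∃ z : Fin t.length → Fin N,
      Colours S x (List.ofFn z) f ∧ Colours T (List.ofFn z) y g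
  · rw [if_pos h]
    obtain ⟨z, hz⟩ := h
    rw [Finset.sum_eq_single z, if_pos hz]
    · intro w _ hw
      exact if_neg fun h => hw (colours_bot_unique S h.1 hz.1)
    · simp
  · rw [if_neg h]
    exact (Finset.sum_eq_zero fun z _ => if_neg fun hz => h ⟨z, hz⟩).symm

theorem colours_tensor {s t s' t' : List Dir} (S : Planar s t) (T : Planar s' t')
    (x y : List (Fin N)) (f : Arc S → Fin N) (g : Arc T → Fin N) :
    Colours (.tensor S T) x y (Sum.elim f g) ↔
      Colours S (x.take s.length) (y.take t.length) f ∧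
        Colours T (x.drop s.length) (y.drop t.length) g := by
  constructor
  · rintro ⟨hG, hx, hy⟩
    refine ⟨⟨fun a b h => hG (.inl a) (.inl b) h, fun i a h => ?_, fun i a h => ?_⟩,
      fun a b h => hG (.inr a) (.inr b) h, fun i a h => ?_, fun i a h => ?_⟩
    · rw [List.getElem?_take_of_lt (atTop_lt S h)]
      exact hx i (.inl a) h
    · rw [List.getElem?_take_of_lt (atBot_lt S h)]
      exact hy i (.inl a) h
    · rw [List.getElem?_drop]
      exact hx _ (.inr a) ⟨i, rfl, h⟩
    · rw [List.getElem?_drop]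
      exact hy _ (.inr a) ⟨i, rfl, h⟩
  · rintro ⟨⟨hS, hx, hy⟩, hT, hx', hy'⟩
    refine ⟨?_, ?_, ?_⟩
    · rintro (a | a) (b | b) h
      · exact hS a b h
      · cases h
      · cases h
      · exact hT a b h
    · rintro i (a | a) h
      · rw [← List.getElem?_take_of_lt (atTop_lt S h)]
        exact hx i a h
      · obtain ⟨j, rfl, h⟩ := h
        rw [← List.getElem?_drop]
        exact hx' j a h
    · rintro i (a | a) h
      · rw [← List.getElem?_take_of_lt (atBot_lt S h)]
        exact hy i a h
      · obtain ⟨j, rfl, h⟩ := h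
        rw [← List.getElem?_drop]
        exact hy' j a h

open Classical in
theorem colourings_tensor {s t s' t' : List Dir} (S : Planar s t) (T : Planar s' t')
    (x y : List (Fin N)) :
    colourings R (.tensor S T) x y =
      colourings R S (x.take s.length) (y.take t.length) *
        colourings R T (x.drop s.length) (y.drop t.length) := by
  have e : colourings R (.tensor S T) x y = ∑ f : Arc S → Fin N, ∑ g : Arc T → Fin N,
      if Colours (.tensor S T) x y (Sum.elim f g) then 1 else 0 := by
    let e : (Arc S → Fin N) × (Arc T → Fin N) ≃ (Arc (.tensor S T) → Fin N) :=
      (Equiv.sumArrowEquivProdArrow (Arc S) (Arc T) (Fin N)).symm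
    unfold colourings
    rw [← e.sum_comp, Fintype.sum_prod_type]
    rfl
  rw [e]
  simp only [colourings, Finset.sum_mul_sum, colours_tensor, ite_zero_mul_ite_zero, mul_one]

open Classical in
theorem sum_boole_of_iff {α : Type*} [Fintype α] {P : α → Prop} {Q : Prop} [Decidable Q] {c : α}
    (h : ∀ f, P f ↔ f = c ∧ Q) : (∑ f, if P f then 1 else 0 : R) = if Q then 1 else 0 := by
  by_cases hQ : Q <;> simp [h, hQ]

open Classical in
theorem colourings_id (w : List Dir) (x y : List (Fin N)) (hx : x.length = w.length)
    (hy : y.length = w.length) :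
    colourings R (.id w : Planar w w) x y = if x = y then 1 else 0 := by
  have key : ∀ f : Arc (.id w : Planar w w) → Fin N,
      Colours (.id w) x y f ↔ f = (fun i : Fin w.length => x[i.val]) ∧ x = y := by
    intro f
    constructor
    · rintro ⟨-, h₁, h₂⟩
      refine ⟨funext fun i => ?_, List.ext_getElem (hx.trans hy.symm) fun i hi hi' => ?_⟩
      · have := h₁ i.val i rfl
        rw [List.getElem?_eq_getElem (by rw [hx]; exact i.isLt)] at this
        exact (Option.some.inj this).symm
      · have e₁ := h₁ i (⟨i, hx ▸ hi⟩ : Fin w.length) rfl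
        have e₂ := h₂ i (⟨i, hx ▸ hi⟩ : Fin w.length) rfl
        rw [List.getElem?_eq_getElem hi] at e₁
        rw [List.getElem?_eq_getElem hi'] at e₂
        exact Option.some.inj (e₁.trans e₂.symm)
    · rintro ⟨rfl, rfl⟩
      refine ⟨fun _ _ h => h.elim, ?_, ?_⟩ <;>
      · rintro i a rfl
        exact List.getElem?_eq_getElem _
  exact sum_boole_of_iff (R := R) key

theorem list_eq_pair {α : Type*} {l : List α} (h : l.length = 2) : ∃ a b, l = [a, b] := by
  rcases l with _ | ⟨a, _ | ⟨b, _ | ⟨c, l⟩⟩⟩ <;> simp at h ⊢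

open Classical in
theorem colourings_cap (a : Dir) (i j : Fin N) :
    colourings R (.cap a : Planar _ _) [] [i, j] = if i = j then 1 else 0 := by
  have key : ∀ f : Arc (.cap a : Planar _ _) → Fin N,
      Colours (.cap a) [] [i, j] f ↔ f = (fun _ => i) ∧ i = j := by
    intro f
    constructor
    · rintro ⟨-, -, h⟩
      have h₀ := h 0 () Nat.zero_lt_two
      have h₁ := h 1 () Nat.one_lt_two
      simp only [List.getElem?_cons_zero, List.getElem?_cons_succ, Option.some.injEq] at h₀ h₁
      exact ⟨funext fun _ => h₀.symm, h₀.trans h₁.symm⟩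
    · rintro ⟨rfl, rfl⟩
      refine ⟨fun _ _ h => h.elim, fun _ _ h => h.elim, fun k _ hk => ?_⟩
      change k < 2 at hk
      interval_cases k <;> rfl
  exact sum_boole_of_iff (R := R) key

open Classical in
theorem colourings_cup (a : Dir) (i j : Fin N) :
    colourings R (.cup a : Planar _ _) [i, j] [] = if i = j then 1 else 0 := by
  have key : ∀ f : Arc (.cup a : Planar _ _) → Fin N,
      Colours (.cup a) [i, j] [] f ↔ f = (fun _ => i) ∧ i = j := by
    intro f
    constructor
    · rintro ⟨-, h, -⟩
      have h₀ := h 0 () Nat.zero_lt_two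
      have h₁ := h 1 () Nat.one_lt_two
      simp only [List.getElem?_cons_zero, List.getElem?_cons_succ, Option.some.injEq] at h₀ h₁
      exact ⟨funext fun _ => h₀.symm, h₀.trans h₁.symm⟩
    · rintro ⟨rfl, rfl⟩
      refine ⟨fun _ _ h => h.elim, fun k _ hk => ?_, fun _ _ h => h.elim⟩
      change k < 2 at hk
      interval_cases k <;> rfl
  exact sum_boole_of_iff (R := R) key

/-- With all arc weights `1` every entry is an indicator, so the state sum counts compatible
labellings. -/
theorem stateSum_one_eq_colourings {s t : List Dir} (T : Planar s t) (x y : List (Fin N))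
    (hx : x.length = s.length) (hy : y.length = t.length) :
    stateSum (fun _ => 1) (fun _ => 1) noWeight T x y = colourings R T x y := by
  induction T generalizing x y with
  | id w => rw [colourings_id w x y hx hy]; simp only [stateSum]
  | cap a =>
    obtain rfl := List.length_eq_zero_iff.1 hx
    obtain ⟨i, j, rfl⟩ := list_eq_pair hy
    rw [colourings_cap]
    cases a <;> simp only [stateSum, capWeight]
  | cup a =>
    obtain rfl := List.length_eq_zero_iff.1 hy
    obtain ⟨i, j, rfl⟩ := list_eq_pair hx
    rw [colourings_cup]
    cases a <;> simp only [stateSum, cupWeight]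
  | vertex c => cases c
  | comp S T hS hT =>
    rw [colourings_comp]
    exact wsum_congr fun w hw => by rw [hS _ _ hx hw, hT _ _ hw hy]
  | tensor S T hS hT =>
    simp only [List.length_append] at hx hy
    simp only [stateSum]
    rw [hS _ _ (by simp [hx]) (by simp [hy]), hT _ _ (by simp [hx]) (by simp [hy]),
      colourings_tensor]

open Classical in
theorem colourings_closed (T : Closed NoVertex) :
    colourings R (N := N) T [] [] = (N : R) ^ cycles T := by
  have key : ∀ f : Arc T → Fin N, Colours T [] [] f ↔ ∀ a b, Glued T a b → f a = f b :=
    fun f => ⟨fun h => h.1, fun h => ⟨h, fun i a hi => absurd (atTop_lt T hi) (Nat.not_lt_zero i),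
      fun i a hi => absurd (atBot_lt T hi) (Nat.not_lt_zero i)⟩⟩
  let e : {f : Arc T → Fin N // ∀ a b, Glued T a b → f a = f b} ≃ (Quot (Glued T) → Fin N) :=
    { toFun := fun f => Quot.lift f.1 f.2
      invFun := fun g => ⟨fun a => g (Quot.mk _ a), fun a b h => congrArg g (Quot.sound h)⟩
      left_inv := fun f => rfl
      right_inv := fun g => funext fun a => by induction a using Quot.ind; rfl }
  have : Finite (Quot (Glued T)) := Quot.finite _
  unfold colourings
  simp only [key]
  rw [Finset.sum_boole, ← Fintype.card_subtype, ← Nat.card_eq_fintype_card, Nat.card_congr e,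
    Nat.card_fun, Nat.card_eq_fintype_card (α := Fin N), Fintype.card_fin]
  simp [cycles]

theorem stateSum_one_eq_planarP (φ φ' : R) (L : LockDiagram) :
    stateSum (fun _ : Fin N => 1) (fun _ => 1) (lockWeight (fun _ => 1) (fun _ => 1) φ φ') L [] [] =
      planarP (N : R) φ φ' L := by
  rw [stateSum_lockWeight]
  unfold resolutionSum planarP
  refine congrArg List.sum (List.map_congr_left fun r _ => ?_)
  rw [stateSum_one_eq_colourings _ _ _ rfl rfl, colourings_closed]

end

theorem map_planarP {R S : Type*} [CommRing R] [CommRing S] (f : R →+* S) (D φ φ' : R)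
    (L : LockDiagram) : f (planarP D φ φ' L) = planarP (f D) (f φ) (f φ') L := by
  simp [planarP, map_list_sum, Function.comp_def]

theorem map_chainCoeff {R S : Type*} [CommRing R] [CommRing S] (f : R →+* S) (D φ φ' : R)
    (n : ℤ) : f (chainCoeff D φ φ' n) = chainCoeff (f D) (f φ) (f φ') n := by
  cases n <;> simp [chainCoeff]

/-- It suffices to prove the identity over `ℤ[x, y][D]`, which maps to any triple `D`, `φ`, `φ'`.
Over this domain of characteristic zero the values `D = N` are infinitely many points. -/
theorem planarP_doubleBraid {R : Type*} [CommRing R] (D φ φ' : R) (m n : ℤ) :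
    planarP D φ φ' (doubleBraid m n) =
      D + (chainCoeff D φ φ' n + chainCoeff D φ φ' m) * D ^ 2 +
        chainCoeff D φ φ' n * chainCoeff D φ φ' m * D := by
  let x : MvPolynomial (Fin 2) ℤ := MvPolynomial.X 0
  let y : MvPolynomial (Fin 2) ℤ := MvPolynomial.X 1
  have key : planarP Polynomial.X (Polynomial.C x) (Polynomial.C y) (doubleBraid m n) =
      Polynomial.X + (chainCoeff Polynomial.X (Polynomial.C x) (Polynomial.C y) n +
        chainCoeff Polynomial.X (Polynomial.C x) (Polynomial.C y) m) * Polynomial.X ^ 2 +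
        chainCoeff Polynomial.X (Polynomial.C x) (Polynomial.C y) n *
          chainCoeff Polynomial.X (Polynomial.C x) (Polynomial.C y) m * Polynomial.X := by
    refine Polynomial.eq_of_infinite_eval_eq _ _
      ((Set.infinite_range_of_injective (Nat.cast_injective (R := MvPolynomial (Fin 2) ℤ))).mono ?_)
    rintro _ ⟨N, rfl⟩
    have h := stateSum_doubleBraid (κ := fun _ : Fin N => (1 : MvPolynomial (Fin 2) ℤ))
      (κ' := fun _ => 1) x y (D := N) (by simp) (by simp) (by simp) m n
    rw [stateSum_one_eq_planarP] at h
    simp only [Set.mem_ofPred_eq, ← Polynomial.coe_evalRingHom, map_planarP, map_add, map_mul,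
      map_pow, map_chainCoeff]
    simpa using h
  have := congrArg (Polynomial.eval₂RingHom
    (MvPolynomial.eval₂Hom (Int.castRingHom R) ![φ, φ']) D) key
  simp only [map_planarP, map_chainCoeff, map_add, map_mul, map_pow] at this
  simpa [x, y] using this


/-! ### The Reshetikhin-Turaev weights of the locks -/

section Braiding

variable {R : Type*} [CommRing R] {N : ℕ}

/-- A matrix of the shape of the fundamental `R`-matrix: `p` on equal labels, transpositions with
coefficient `1`, and a diagonal part `u`. -/
def braiding (p : R) (u : Fin N → Fin N → R) (a b c d : Fin N) : R :=
  (if a = d then if b = c then if a = b then p else 1 else 0 else 0) +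
    if a = c then if b = d then u c d else 0 else 0

variable {κ κ' : Fin N → R} {p φ : R} {u : Fin N → Fin N → R}

/-- Of the four products, transposition times transposition gives `smoothH` plus the correction `p ^
2 - 1` on equal labels. The other three contribute only when `a = c` and `b = d`; with this
correction they add up to the left side of `hV`. The mixed products vanish for `a = b` by `hu`. -/
theorem sum_braiding_vert (hu : ∀ a, u a a = 0)
    (hV : ∀ a b, (∑ i, κ' i * u i a * u i b) + (if a = b then (p ^ 2 - 1) * κ' a else
      p * (κ' a * u a b + κ' b * u b a)) = φ) (a b c d : Fin N) :
    ∑ i, ∑ j, κ' i * (braiding p u j c i a * braiding p u i b j d) =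
      φ * (if a = c then if b = d then 1 else 0 else 0) +
        if a = b then if c = d then κ' c else 0 else 0 := by
  have h := hV a b
  simp only [mul_assoc] at h
  simp only [braiding, mul_add, add_mul, Finset.sum_add_distrib]
  simp
  by_cases hbd : b = d
  · subst hbd
    by_cases hac : a = c
    · subst hac
      by_cases hab : a = b
      · subst hab
        simp [hu] at h ⊢
        linear_combination h
      · simp [hab, Ne.symm hab] at h ⊢
        linear_combination h
    · simp [hac, Ne.symm hac]
      grind
  · simp [hbd, Ne.symm hbd]
    grind

/-- The roles of the two resolutions are exchanged: transposition times transposition now gives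
`smoothV`, with `κ c * κ' c = 1`, and the rest is `hH` at the labels `a`, `c` of the upper and the
lower arc. -/
theorem sum_braiding_horiz (h : ∀ i, κ i * κ' i = 1) (hu : ∀ a, u a a = 0)
    (hH : ∀ a b, (∑ i, κ i * u a i * u b i) + (if a = b then (p ^ 2 - 1) * κ a else
      p * (κ a * u b a + κ b * u a b)) = φ) (a b c d : Fin N) :
    ∑ i, ∑ j, braiding p u b j a i * (κ' c * κ j * braiding p u c i d j) =
      (if a = c then if b = d then 1 else 0 else 0) +
        φ * if a = b then if c = d then κ' c else 0 else 0 := by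
  have h₁ := hH a c
  have h₂ := h c
  have e : ∑ x, u a x * (κ' c * κ x * u c x) = κ' c * ∑ x, κ x * u a x * u c x := by
    rw [Finset.mul_sum]
    exact Finset.sum_congr rfl fun _ _ => by ring
  simp only [braiding, mul_add, add_mul, Finset.sum_add_distrib]
  simp
  by_cases hcd : c = d
  · subst hcd
    by_cases hba : b = a
    · subst hba
      by_cases hbc : b = c
      · subst hbc
        simp [hu] at h₁ ⊢
        rw [e]
        linear_combination κ' b * h₁ + h₂
      · simp [hbc] at h₁ ⊢
        rw [e]
        linear_combination κ' c * h₁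
    · simp [hba, Ne.symm hba]
      grind
  · simp [hcd]
    grind

end Braiding

/-! ### Matrices of rotated crossings and of the lock tangles. -/

section Cross

variable {R : Type*} [CommRing R] {N : ℕ} (κ κ' : Fin N → R)
  (v : ∀ s t : List Dir, Crossing s t → List (Fin N) → List (Fin N) → R)

theorem stateSum_cap_right_of_down_down {t : List Dir} (T : Tangle Crossing [down, down, up, down] t)
    (a b : Fin N) (y : List (Fin N)) :
    stateSum κ κ' v (.comp (t := [down, down, up, down])
      (.tensor (s := [down, down]) (t := [down, down]) (s' := []) (t' := [up, down])
        (.id [down, down]) (.cap up)) T) [a, b] y =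
      ∑ i, stateSum κ κ' v T [a, b, i, i] y := by
  simp only [stateSum, wsum, capWeight]
  simp [ite_and]

theorem stateSum_cap_inside_of_down_down_up {t : List Dir} (T : Tangle Crossing [down, down, up, up, down, down] t)
    (a b c d : Fin N) (y : List (Fin N)) :
    stateSum κ κ' v (.comp (t := [down, down, up, up, down, down])
      (.tensor (s := [down, down, up]) (t := [down, down, up]) (s' := [down])
        (t' := [up, down, down]) (.id [down, down, up])
        (.tensor (s := []) (t := [up, down]) (.cap up) (.id [down]))) T) [a, b, c, d] y =
      ∑ i, stateSum κ κ' v T [a, b, c, i, i, d] y := by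
  simp only [stateSum, wsum, capWeight]
  simp [ite_and]

theorem stateSum_crossUp_inside_four {t : List Dir} (T : Tangle Crossing [down, down, up, up, down, down] t)
    (e : Sgn) (a b c d f g : Fin N) (y : List (Fin N)) :
    stateSum κ κ' v (.comp (t := [down, down, up, up, down, down])
      (.tensor (s := [down, down]) (t := [down, down]) (s' := [up, up, down, down])
        (t' := [up, up, down, down]) (.id [down, down])
        (.tensor (crossUp e) (.id [down, down]))) T) [a, b, c, d, f, g] y =
      ∑ i, ∑ j, v _ _ (.crossing e) [c, d] [i, j] * stateSum κ κ' v T [a, b, i, j, f, g] y := by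
  simp only [stateSum, wsum, crossUp]
  simp [ite_and]

theorem stateSum_cup_inside {t : List Dir} (T : Tangle Crossing [down, up, down, down] t)
    (a b c d f g : Fin N) (y : List (Fin N)) :
    stateSum κ κ' v (.comp (t := [down, up, down, down])
      (.tensor (s := [down]) (t := [down]) (s' := [down, up, up, down, down])
        (t' := [up, down, down]) (.id [down])
        (.tensor (s := [down, up]) (t := []) (.cup down) (.id [up, down, down]))) T) [a, b, c, d, f, g] y =
      if b = c then stateSum κ κ' v T [a, d, f, g] y else 0 := by
  simp only [stateSum, wsum, cupWeight]
  simp [ite_and]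

theorem stateSum_cap_right_of_down_up {t : List Dir} (T : Tangle Crossing [down, up, up, down] t)
    (a b : Fin N) (y : List (Fin N)) :
    stateSum κ κ' v (.comp (t := [down, up, up, down])
      (.tensor (s := [down, up]) (t := [down, up]) (s' := []) (t' := [up, down])
        (.id [down, up]) (.cap up)) T) [a, b] y =
      ∑ i, stateSum κ κ' v T [a, b, i, i] y := by
  simp only [stateSum, wsum, capWeight]
  simp [ite_and]

theorem stateSum_crossUp_inside_two {t : List Dir} (T : Tangle Crossing [down, up, up, down] t)
    (e : Sgn) (a b c d : Fin N) (y : List (Fin N)) :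
    stateSum κ κ' v (.comp (t := [down, up, up, down])
      (.tensor (s := [down]) (t := [down]) (s' := [up, up, down]) (t' := [up, up, down])
        (.id [down]) (.tensor (crossUp e) (.id [down]))) T) [a, b, c, d] y =
      ∑ i, ∑ j, v _ _ (.crossing e) [b, c] [i, j] * stateSum κ κ' v T [a, i, j, d] y := by
  simp only [stateSum, wsum, crossUp]
  simp

theorem stateSum_cap_left_of_up_down {t : List Dir} (T : Tangle Crossing [down, up, up, down] t)
    (a b : Fin N) (y : List (Fin N)) :
    stateSum κ κ' v (.comp (t := [down, up, up, down])
      (.tensor (s := []) (t := [down, up]) (.cap down) (.id [up, down])) T) [a, b] y =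
      ∑ i, κ' i * stateSum κ κ' v T [i, i, a, b] y := by
  simp only [stateSum, wsum, capWeight]
  simp [ite_and]

theorem stateSum_cap_inside_of_down_up {t : List Dir} (T : Tangle Crossing [down, down, up, up] t)
    (a b : Fin N) (y : List (Fin N)) :
    stateSum κ κ' v (.comp (t := [down, down, up, up])
      (.tensor (s := [down]) (t := [down]) (s' := [up]) (t' := [down, up, up]) (.id [down])
        (.tensor (s := []) (t := [down, up]) (.cap down) (.id [up]))) T) [a, b] y =
      ∑ i, κ' i * stateSum κ κ' v T [a, i, i, b] y := by
  simp only [stateSum, wsum, capWeight]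
  simp

theorem stateSum_tensor_down_down_up_up {t : List Dir} (T : Tangle Crossing [down, down, up, up] t)
    (P : Tangle Crossing [down, down] [down, down])
    (Q : Tangle Crossing [up, up] [up, up]) (a b c d : Fin N) (y : List (Fin N)) :
    stateSum κ κ' v (.comp (t := [down, down, up, up])
      (.tensor P Q) T) [a, b, c, d] y =
      ∑ i, ∑ j, ∑ k, ∑ l,
        stateSum κ κ' v P [a, b] [i, j] * stateSum κ κ' v Q [c, d] [k, l] *
          stateSum κ κ' v T [i, j, k, l] y := by
  simp only [stateSum, wsum]
  simp

/-- The rotation uses only `cap up` and `cup down`, which have weight `1`; the same holds for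
`crossRight`. In contrast, `crossLeft` uses `cap down` and `cup up` and acquires the factor `κ' c *
κ b`. -/
theorem stateSum_crossDown (e : Sgn) (a b c d : Fin N) :
    stateSum κ κ' v (crossDown e) [a, b] [c, d] = v _ _ (.crossing e) [d, c] [b, a] := by
  simp only [crossDown, stateSum_cap_right_of_down_down, stateSum_cap_inside_of_down_down_up,
    stateSum_crossUp_inside_four, stateSum_cup_inside]
  simp [stateSum, cupWeight, ite_and]

theorem stateSum_crossRight (e : Sgn) (a b c d : Fin N) :
    stateSum κ κ' v (crossRight e) [a, b] [c, d] = v _ _ (.crossing e) [b, d] [a, c] := by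
  simp only [crossRight, stateSum_cap_right_of_down_up, stateSum_crossUp_inside_two]
  simp [stateSum, cupWeight, ite_and]

theorem stateSum_crossLeft (e : Sgn) (a b c d : Fin N) :
    stateSum κ κ' v (crossLeft e) [a, b] [c, d] =
      κ' c * κ b * v _ _ (.crossing e) [c, a] [d, b] := by
  simp only [crossLeft, stateSum_cap_left_of_up_down, stateSum_crossUp_inside_two]
  simp [stateSum, cupWeight, ite_and, mul_assoc, mul_comm (κ b)]

theorem stateSum_lockTangle_vert (e : Sgn) (a b c d : Fin N) :
    stateSum κ κ' v (lockTangle _ _ (.vert e)) [a, b] [c, d] =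
      ∑ i, ∑ j, κ' i * (v _ _ (.crossing e) [j, c] [i, a] * v _ _ (.crossing e) [i, b] [j, d]) := by
  simp only [lockTangle, stateSum_cap_inside_of_down_up, stateSum_tensor_down_down_up_up,
    stateSum_crossDown]
  simp [stateSum, cupWeight, crossUp, Finset.mul_sum]

theorem stateSum_lockTangle_horiz (e : Sgn) (a b c d : Fin N) :
    stateSum κ κ' v (lockTangle _ _ (.horiz e)) [a, b] [c, d] =
      ∑ i, ∑ j, v _ _ (.crossing e) [b, j] [a, i] *
        (κ' c * κ j * v _ _ (.crossing e) [c, i] [d, j]) := by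
  simp only [lockTangle, stateSum, wsum, stateSum_crossRight, stateSum_crossLeft]

end Cross

/-! ### The `R`-matrix, quantum trace weights and the value of a lock. -/

section Field

variable {K : Type*} [Field K] {N : ℕ}

/-- The diagonal part of the `R`-matrix. -/
def diagPart (q : K) : Sgn → Fin N → Fin N → K
  | .pos, c, d => if c < d then q - q⁻¹ else 0
  | .neg, c, d => if d < c then -(q - q⁻¹) else 0

/-- The entries of the `R`-matrix on equal labels. -/
def equalPart (q : K) : Sgn → K
  | .pos => q
  | .neg => q⁻¹

theorem rMatrix_eq_braiding (q : K) (e : Sgn) (a b c d : Fin N) :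
    rMatrix q e a b c d = braiding (equalPart q e) (diagPart q e) a b c d := by
  cases e <;> unfold rMatrix braiding equalPart diagPart <;> grind

theorem sum_range_lt_sub (f : ℕ → K) (m M : ℕ) (h : m ≤ M) :
    ∑ i ∈ Finset.range M, (if i < m then f i - f (i + 1) else 0) = f 0 - f m := by
  rw [← Finset.sum_filter, show (Finset.range M).filter (· < m) = Finset.range m by
    ext; simp; omega, Finset.sum_range_sub']

/-- The full telescoping sum minus its initial segment of length `m + 1`. -/
theorem sum_range_gt_sub (f : ℕ → K) (m M : ℕ) (h : m < M) :
    ∑ i ∈ Finset.range M, (if m < i then f (i + 1) - f i else 0) = f M - f (m + 1) := by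
  have := Finset.sum_range_sub f M
  have h₂ := sum_range_lt_sub f (m + 1) M h
  have h₃ : ∑ i ∈ Finset.range M, (if m < i then f (i + 1) - f i else 0) =
      ∑ i ∈ Finset.range M, ((f (i + 1) - f i) + if i < m + 1 then f i - f (i + 1) else 0) :=
    Finset.sum_congr rfl fun i _ => by split_ifs <;> first | omega | ring
  rw [h₃, Finset.sum_add_distrib, this, h₂]
  ring

/-- The weights of the quantum trace. -/
def arcWeight (q : K) (i : Fin N) : K := q ^ (2 * (i.val : ℤ) + 1 - N)

theorem arcWeight_mul_arcWeight_inv {q : K} (hq : q ≠ 0) (i : Fin N) :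
    arcWeight q i * arcWeight q⁻¹ i = 1 := by
  rw [arcWeight, arcWeight, ← mul_zpow, mul_inv_cancel₀ hq, one_zpow]

theorem mul_sum_arcWeight {q : K} (hq : q ≠ 0) :
    (q - q⁻¹) * ∑ i : Fin N, arcWeight q i = q ^ N - (q ^ N)⁻¹ := by
  have e : ∀ i : ℕ, (q - q⁻¹) * q ^ (2 * (i : ℤ) + 1 - N) =
      q ^ (2 * ((i + 1 : ℕ) : ℤ) - N) - q ^ (2 * (i : ℤ) - N) := fun i => by
    rw [show 2 * ((i + 1 : ℕ) : ℤ) - N = 2 * (i : ℤ) - N + 1 + 1 by push_cast; ring,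
      show 2 * (i : ℤ) + 1 - N = 2 * (i : ℤ) - N + 1 by ring, zpow_add_one₀ hq, zpow_add_one₀ hq,
        zpow_add_one₀ hq]
    generalize q ^ (2 * (i : ℤ) - N) = z
    field_simp
  unfold arcWeight
  rw [Finset.mul_sum, Finset.sum_congr rfl fun (i : Fin N) _ => e i.val,
    Fin.sum_univ_eq_sum_range fun i : ℕ =>
      q ^ (2 * ((i + 1 : ℕ) : ℤ) - N) - q ^ (2 * (i : ℤ) - N),
    Finset.sum_range_sub fun i : ℕ => q ^ (2 * (i : ℤ) - N)]
  rw [show 2 * (N : ℤ) - N = N by ring]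
  simp

/-- Each term times `{q}` is a difference of consecutive powers with step `q⁻²`. The sum telescopes
from `q ^ N` down to `q ^ (N - 2 a)`, which is `q * arcWeight q⁻¹ a`. -/
theorem mul_sum_lt_arcWeight_inv {q : K} (hq : q ≠ 0) (a : Fin N) :
    (q - q⁻¹) * ∑ i : Fin N, (if i < a then arcWeight q⁻¹ i else 0) =
      q ^ N - q * arcWeight q⁻¹ a := by
  have e : ∀ i : ℕ, (q - q⁻¹) * (if i < a.val then q⁻¹ ^ (2 * (i : ℤ) + 1 - N) else 0) =
      if i < a.val then q⁻¹ ^ (2 * (i : ℤ) - N) - q⁻¹ ^ (2 * ((i + 1 : ℕ) : ℤ) - N) else 0 :=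
    fun i => by
      rw [show 2 * ((i + 1 : ℕ) : ℤ) - N = 2 * (i : ℤ) - N + 1 + 1 by push_cast; ring,
        show 2 * (i : ℤ) + 1 - N = 2 * (i : ℤ) - N + 1 by ring,
        zpow_add_one₀ (inv_ne_zero hq), zpow_add_one₀ (inv_ne_zero hq),
        zpow_add_one₀ (inv_ne_zero hq)]
      generalize q⁻¹ ^ (2 * (i : ℤ) - N) = z
      split_ifs
      · field_simp
      · ring
  unfold arcWeight
  simp only [Fin.lt_def]
  rw [Finset.mul_sum, Finset.sum_congr rfl fun (i : Fin N) _ => e i.val,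
    Fin.sum_univ_eq_sum_range fun i : ℕ =>
      if i < a.val then q⁻¹ ^ (2 * (i : ℤ) - N) - q⁻¹ ^ (2 * ((i + 1 : ℕ) : ℤ) - N) else 0,
    sum_range_lt_sub (fun i : ℕ => q⁻¹ ^ (2 * (i : ℤ) - N)) _ _ a.isLt.le,
    show 2 * (a.val : ℤ) + 1 - N = 2 * (a.val : ℤ) - N + 1 by ring,
    zpow_add_one₀ (inv_ne_zero hq)]
  field_simp
  simp

theorem mul_sum_gt_arcWeight {q : K} (hq : q ≠ 0) (a : Fin N) :
    (q - q⁻¹) * ∑ i : Fin N, (if a < i then arcWeight q i else 0) =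
      q ^ N - q * arcWeight q a := by
  have e : ∀ i : ℕ, (q - q⁻¹) * (if a.val < i then q ^ (2 * (i : ℤ) + 1 - N) else 0) =
      if a.val < i then q ^ (2 * ((i + 1 : ℕ) : ℤ) - N) - q ^ (2 * (i : ℤ) - N) else 0 :=
    fun i => by
      rw [show 2 * ((i + 1 : ℕ) : ℤ) - N = 2 * (i : ℤ) - N + 1 + 1 by push_cast; ring,
        show 2 * (i : ℤ) + 1 - N = 2 * (i : ℤ) - N + 1 by ring,
        zpow_add_one₀ hq, zpow_add_one₀ hq,
        zpow_add_one₀ hq]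
      generalize q ^ (2 * (i : ℤ) - N) = z
      split_ifs
      · field_simp
      · ring
  unfold arcWeight
  simp only [Fin.lt_def]
  rw [Finset.mul_sum, Finset.sum_congr rfl fun (i : Fin N) _ => e i.val,
    Fin.sum_univ_eq_sum_range fun i : ℕ =>
      if a.val < i then q ^ (2 * ((i + 1 : ℕ) : ℤ) - N) - q ^ (2 * (i : ℤ) - N) else 0,
    sum_range_gt_sub (fun i : ℕ => q ^ (2 * (i : ℤ) - N)) _ _ a.isLt,
    show 2 * ((a.val + 1 : ℕ) : ℤ) - N = 2 * (a.val : ℤ) + 1 - N + 1 by push_cast; ring,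
    zpow_add_one₀ hq, show 2 * (N : ℤ) - N = N by ring, mul_comm q, zpow_natCast]

/-- The expression is symmetric in `a`, `b`, so let `a ≤ b`. The sum runs over `i < a` and
telescopes to `{q} (q ^ N - q κ' a)`; the second summand is `q {q} κ' a` both for `a = b` and for `a
< b`, so the dependence on the labels cancels. -/
theorem kink_vert_pos {q : K} (hq : q ≠ 0) (a b : Fin N) :
    (∑ i, arcWeight q⁻¹ i * diagPart q .pos i a * diagPart q .pos i b) +
      (if a = b then (q ^ 2 - 1) * arcWeight q⁻¹ a else
        q * (arcWeight q⁻¹ a * diagPart q .pos a b + arcWeight q⁻¹ b * diagPart q .pos b a)) =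
      q ^ N * (q - q⁻¹) := by
  wlog h : a ≤ b generalizing a b
  · rw [← this b a (le_of_not_ge h)]
    simp only [eq_comm (a := b)]
    congr 1
    · exact Finset.sum_congr rfl fun _ _ => by ring
    · split_ifs with hab
      · rw [hab]
      · ring
  have e : ∑ i, arcWeight q⁻¹ i * diagPart q .pos i a * diagPart q .pos i b =
      (q - q⁻¹) * (q ^ N - q * arcWeight q⁻¹ a) := by
    rw [← mul_sum_lt_arcWeight_inv hq a, Finset.mul_sum, Finset.mul_sum]
    refine Finset.sum_congr rfl fun i _ => ?_
    unfold diagPart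
    by_cases hi : i < a
    · simp only [hi, hi.trans_le h, if_true]; ring
    · simp [hi]
  rw [e]
  rcases h.eq_or_lt with rfl | h
  · simp only [if_true]
    field_simp
    ring
  · simp only [h.ne, if_false, diagPart, h, if_true, h.not_gt]
    ring

/-- As in the vertical case, but for `a ≤ b` the sum runs over `i > b` and the compensating term is
`q {q} κ b`. -/
theorem kink_horiz_pos {q : K} (hq : q ≠ 0) (a b : Fin N) :
    (∑ i, arcWeight q i * diagPart q .pos a i * diagPart q .pos b i) +
      (if a = b then (q ^ 2 - 1) * arcWeight q a else
        q * (arcWeight q a * diagPart q .pos b a + arcWeight q b * diagPart q .pos a b)) =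
      q ^ N * (q - q⁻¹) := by
  wlog h : a ≤ b generalizing a b
  · rw [← this b a (le_of_not_ge h)]
    simp only [eq_comm (a := b)]
    congr 1
    · exact Finset.sum_congr rfl fun _ _ => by ring
    · split_ifs with hab
      · rw [hab]
      · ring
  have e : ∑ i, arcWeight q i * diagPart q .pos a i * diagPart q .pos b i =
      (q - q⁻¹) * (q ^ N - q * arcWeight q b) := by
    rw [← mul_sum_gt_arcWeight hq b, Finset.mul_sum, Finset.mul_sum]
    refine Finset.sum_congr rfl fun i _ => ?_
    unfold diagPart
    by_cases hi : b < i
    · simp only [hi, h.trans_lt hi, if_true]; ring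
    · simp [hi]
  rw [e]
  rcases h.eq_or_lt with rfl | h
  · simp only [if_true]
    field_simp
    ring
  · simp only [h.ne, if_false, diagPart, h, if_true, h.not_gt]
    ring

/-- Mirror symmetry: negative crossings are positive ones at `q⁻¹` with the two labels exchanged.
The exchange turns the vertical identity into the horizontal one and conversely, so no new sums
arise for negative locks. -/
theorem diagPart_neg (q : K) (a b : Fin N) : diagPart q .neg a b = diagPart q⁻¹ .pos b a := by
  simp [diagPart]

/-- The factor of the removal of a kink times `{q}`: the coefficient of a lock. -/
def kinkCoeff (N : ℕ) (q : K) : K := q ^ N * (q - q⁻¹)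

theorem kink_vert {q : K} (hq : q ≠ 0) (e : Sgn) (a b : Fin N) :
    (∑ i, arcWeight q⁻¹ i * diagPart q e i a * diagPart q e i b) +
      (if a = b then (equalPart q e ^ 2 - 1) * arcWeight q⁻¹ a else equalPart q e *
        (arcWeight q⁻¹ a * diagPart q e a b + arcWeight q⁻¹ b * diagPart q e b a)) =
      lockCoeff (kinkCoeff N q) (kinkCoeff N q⁻¹) e := by
  cases e with
  | pos => exact kink_vert_pos hq a b
  | neg =>
    simp only [diagPart_neg]
    exact kink_horiz_pos (inv_ne_zero hq) a b

theorem kink_horiz {q : K} (hq : q ≠ 0) (e : Sgn) (a b : Fin N) :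
    (∑ i, arcWeight q i * diagPart q e a i * diagPart q e b i) +
      (if a = b then (equalPart q e ^ 2 - 1) * arcWeight q a else equalPart q e *
        (arcWeight q a * diagPart q e b a + arcWeight q b * diagPart q e a b)) =
      lockCoeff (kinkCoeff N q) (kinkCoeff N q⁻¹) e := by
  cases e with
  | pos => exact kink_horiz_pos hq a b
  | neg =>
    have := kink_vert_pos (inv_ne_zero hq) a b
    rw [inv_inv] at this
    simp only [diagPart_neg, equalPart, lockCoeff, kinkCoeff, inv_inv]
    exact this

theorem diagPart_self (q : K) (e : Sgn) (a : Fin N) : diagPart q e a a = 0 := by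
  cases e <;> simp [diagPart]

/-- The bridge from the `R`-matrix to planar resolutions: it allows the general state sum
computation to be applied to Reshetikhin-Turaev values. -/
theorem stateSum_lockTangle {q : K} (hq : q ≠ 0) {s t : List Dir} (c : Lock s t)
    (x y : List (Fin N)) (hx : x.length = s.length) (hy : y.length = t.length) :
    stateSum (arcWeight q) (arcWeight q⁻¹) (fun _ _ c => crossingWeight q c)
        (lockTangle s t c) x y =
      lockWeight (arcWeight q) (arcWeight q⁻¹) (kinkCoeff N q) (kinkCoeff N q⁻¹) s t c x y := by
  cases c with
  | vert e =>
    obtain ⟨a, b, rfl⟩ := list_eq_pair hx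
    obtain ⟨c, d, rfl⟩ := list_eq_pair hy
    rw [stateSum_lockTangle_vert]
    have h := isComb_vert (κ := arcWeight q) (κ' := arcWeight q⁻¹) (kinkCoeff N q)
      (kinkCoeff N q⁻¹) e a b c d
    rw [stateSum] at h
    rw [h, one_mul]
    simp only [crossingWeight, rMatrix_eq_braiding]
    exact sum_braiding_vert (diagPart_self q e) (kink_vert hq e) a b c d
  | horiz e =>
    obtain ⟨a, b, rfl⟩ := list_eq_pair hx
    obtain ⟨c, d, rfl⟩ := list_eq_pair hy
    rw [stateSum_lockTangle_horiz]
    have h := isComb_horiz (κ := arcWeight q) (κ' := arcWeight q⁻¹) (kinkCoeff N q)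
      (kinkCoeff N q⁻¹) e a b c d
    rw [stateSum] at h
    rw [h, one_mul]
    simp only [crossingWeight, rMatrix_eq_braiding]
    exact sum_braiding_horiz (arcWeight_mul_arcWeight_inv hq) (diagPart_self q e)
      (kink_horiz hq e) a b c d

theorem rtMatrix_toLink {q : K} (hq : q ≠ 0) (L : LockDiagram) :
    rtMatrix N q L.toLink [] [] =
      stateSum (N := N) (arcWeight q) (arcWeight q⁻¹)
        (lockWeight (arcWeight q) (arcWeight q⁻¹) (kinkCoeff N q) (kinkCoeff N q⁻¹))
        L [] [] := by
  have e : (fun i : Fin N => q ^ (-(2 * (i.val : ℤ) + 1 - N))) = arcWeight q⁻¹ := by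
    funext i
    rw [arcWeight, inv_zpow']
  rw [rtMatrix_eq_stateSum, e, LockDiagram.toLink, stateSum_subst]
  exact stateSum_congr _ _ (fun s t c x y hx hy => stateSum_lockTangle hq c x y hx hy) L [] []
    rfl rfl

theorem sum_arcWeight {q : K} (hq : q ≠ 0) (h : q - q⁻¹ ≠ 0) :
    ∑ i : Fin N, arcWeight q i = (q ^ N - (q ^ N)⁻¹) / (q - q⁻¹) := by
  rw [eq_div_iff h, mul_comm, mul_sum_arcWeight hq]

theorem sum_arcWeight_inv {q : K} (hq : q ≠ 0) (h : q - q⁻¹ ≠ 0) :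
    ∑ i : Fin N, arcWeight q⁻¹ i = (q ^ N - (q ^ N)⁻¹) / (q - q⁻¹) := by
  have := mul_sum_arcWeight (N := N) (inv_ne_zero hq)
  rw [eq_div_iff h, mul_comm]
  rw [inv_inv, inv_pow, inv_inv] at this
  linear_combination -this

end Field

/-! ### Writhe -/

/-- The sign as a number. -/
def Sgn.toInt : Sgn → ℤ
  | .pos => 1
  | .neg => -1

theorem writhe_crossUp (e : Sgn) : writhe (crossUp e) = e.toInt := by cases e <;> rfl

theorem writhe_lockTangle {s t : List Dir} (c : Lock s t) :
    writhe (lockTangle s t c) = 2 * (match c with | .vert e => e.toInt | .horiz e => e.toInt) := by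
  cases c <;>
    simp [lockTangle, crossDown, crossRight, crossLeft, writhe, writhe_crossUp, two_mul]

theorem writhe_stack (e : Sgn) (k : ℕ) :
    writhe ((stack e k).subst lockTangle) = 2 * (e.toInt * k) := by
  induction k with
  | zero => simp [stack, smoothV, subst, writhe]
  | succ k ih =>
    simp only [stack, subst, writhe, ih, writhe_lockTangle]
    push_cast; ring

theorem writhe_row (e : Sgn) (k : ℕ) :
    writhe ((row e k).subst lockTangle) = 2 * (e.toInt * k) := by
  induction k with
  | zero => simp [row, smoothH, subst, writhe]
  | succ k ih =>
    simp only [row, sideBySide, subst, writhe, ih, writhe_lockTangle]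
    push_cast; ring

theorem toInt_sgnOf_mul_natAbs (n : ℤ) : (sgnOf n).toInt * n.natAbs = n := by
  cases n with
  | ofNat n => simp [sgnOf, Sgn.toInt]
  | negSucc n => simp [sgnOf, Sgn.toInt]; omega

theorem writhe_doubleBraid (m n : ℤ) : writhe (doubleBraid m n).toLink = 2 * m + 2 * n := by
  simp [LockDiagram.toLink, doubleBraid, close, subst, writhe, verticalChain, horizontalChain,
    writhe_stack, writhe_row, toInt_sgnOf_mul_natAbs, -Nat.cast_natAbs]

theorem writhe_aptLink (n : ℤ) : writhe (aptLink n).toLink = 2 * n := by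
  simp [LockDiagram.toLink, aptLink, close, subst, writhe, verticalChain,
    writhe_stack, toInt_sgnOf_mul_natAbs, -Nat.cast_natAbs]


/-! ### Evaluation in a field -/

section Evaluation

theorem chainCoeff_natCast_mul {R : Type*} [CommRing R] (D φ φ' : R) (k : ℕ) :
    chainCoeff D φ φ' k * D = (1 + φ * D) ^ k - 1 := by
  induction k with
  | zero => simp [chainCoeff]
  | succ k ih =>
    rw [chainCoeff_natCast_succ, pow_succ]
    linear_combination (1 + φ * D) * ih

variable {F : Type*} [Field F]

/-- The hypothesis says that locks of opposite sign contribute inverse factors, so negative chains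
give negative powers of the same number. -/
theorem chainCoeff_mul {D φ φ' : F} (h : (1 + φ * D) * (1 + φ' * D) = 1) (n : ℤ) :
    chainCoeff D φ φ' n * D = (1 + φ * D) ^ n - 1 := by
  obtain ⟨k, rfl | rfl⟩ := n.eq_nat_or_neg
  · rw [chainCoeff_natCast_mul, zpow_natCast]
  · rw [chainCoeff_neg_natCast, chainCoeff_natCast_mul, zpow_neg, zpow_natCast, ← inv_pow,
      inv_eq_of_mul_eq_one_right h]

/-- The quantum dimension `{A} / {q}`. -/
def qdim (A q : F) : F := (A - A⁻¹) / (q - q⁻¹)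

variable {A q : F}

theorem one_add_mul_qdim (hA : A ≠ 0) (hq' : q - q⁻¹ ≠ 0) :
    1 + A * (q - q⁻¹) * qdim A q = A ^ 2 := by
  have : (q - q⁻¹) * qdim A q = A - A⁻¹ := mul_div_cancel₀ _ hq'
  rw [mul_assoc, this]
  field_simp
  ring

theorem one_sub_mul_qdim (hA : A ≠ 0) (hq' : q - q⁻¹ ≠ 0) :
    1 + -A⁻¹ * (q - q⁻¹) * qdim A q = (A ^ 2)⁻¹ := by
  have : (q - q⁻¹) * qdim A q = A - A⁻¹ := mul_div_cancel₀ _ hq'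
  rw [mul_assoc, this]
  field_simp
  ring

theorem chainCoeff_mul_qdim (hA : A ≠ 0) (hq' : q - q⁻¹ ≠ 0) (n : ℤ) :
    chainCoeff (qdim A q) (A * (q - q⁻¹)) (-A⁻¹ * (q - q⁻¹)) n * qdim A q = A ^ (2 * n) - 1 := by
  rw [chainCoeff_mul, one_add_mul_qdim hA hq', ← zpow_natCast, ← zpow_mul, Nat.cast_ofNat]
  rw [one_add_mul_qdim hA hq', one_sub_mul_qdim hA hq', mul_inv_cancel₀ (pow_ne_zero 2 hA)]

/-- The factor `{A q} {A / q}` of the differential expansion. -/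
def diffFactor (A q : F) : F := (A * q - (A * q)⁻¹) * (A / q - (A / q)⁻¹)

theorem diffFactor_eq (hA : A ≠ 0) (hq : q ≠ 0) :
    diffFactor A q = (A - A⁻¹) ^ 2 - (q - q⁻¹) ^ 2 := by
  unfold diffFactor
  field_simp
  ring

/-- Since `{Aq}{A/q} / {A}² = 1 - D⁻²`, both sides are rational functions of `D`, `A ^ (2 n)` and `A
^ (2 m)`, and these can be treated as independent. -/
theorem doubleBraid_value (hA : A ≠ 0) (hq : q ≠ 0) (hA' : A - A⁻¹ ≠ 0) (hq' : q - q⁻¹ ≠ 0)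
    (m n : ℤ) {x y : F} (hx : x * qdim A q = A ^ (2 * n) - 1)
    (hy : y * qdim A q = A ^ (2 * m) - 1) :
    A ^ (-2 * n - 2 * m) * (qdim A q + (x + y) * qdim A q ^ 2 + x * y * qdim A q) =
      qdim A q * (1 - (1 - A ^ (-2 * m)) * (1 - A ^ (-2 * n)) *
        (diffFactor A q / (A - A⁻¹) ^ 2)) := by
  have hD : qdim A q ≠ 0 := div_ne_zero hA' hq'
  have hX : diffFactor A q / (A - A⁻¹) ^ 2 = 1 - (qdim A q ^ 2)⁻¹ := by
    rw [diffFactor_eq hA hq, qdim]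
    generalize A - A⁻¹ = s at *
    generalize q - q⁻¹ = t at *
    field_simp
  rw [hX, show -2 * n - 2 * m = -(2 * n) + -(2 * m) by ring, zpow_add₀ hA, neg_mul, neg_mul,
    zpow_neg, zpow_neg]
  have ha : A ^ (2 * n) ≠ 0 := zpow_ne_zero _ hA
  have hb : A ^ (2 * m) ≠ 0 := zpow_ne_zero _ hA
  rw [← eq_div_iff hD] at hx hy
  subst hx hy
  generalize A ^ (2 * n) = a at *
  generalize A ^ (2 * m) = b at *
  generalize qdim A q = D at *
  field_simp
  ring

theorem aptLink_value (hA : A ≠ 0) (n : ℤ) {x : F} (hx : x * qdim A q = A ^ (2 * n) - 1) :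
    A ^ (-2 * n) * (qdim A q ^ 2 + x * qdim A q) =
      A ^ (-2 * n) * qdim A q ^ 2 + 1 - A ^ (-2 * n) := by
  have : A ^ (-2 * n) * A ^ (2 * n) = 1 := by
    rw [← zpow_add₀ hA, neg_mul, neg_add_cancel, zpow_zero]
  rw [hx]
  linear_combination this

theorem kinkCoeff_eq (N : ℕ) (q : F) : kinkCoeff N q = q ^ N * (q - q⁻¹) := rfl

theorem kinkCoeff_inv (N : ℕ) (q : F) : kinkCoeff N q⁻¹ = -(q ^ N)⁻¹ * (q - q⁻¹) := by
  rw [kinkCoeff, inv_inv, inv_pow]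
  ring

theorem slInvariant_doubleBraid {N : ℕ} (hq : q ≠ 0) (hq' : q - q⁻¹ ≠ 0)
    (hA' : q ^ N - (q ^ N)⁻¹ ≠ 0) (m n : ℤ) :
    slInvariant N q (doubleBraid m n).toLink =
      qdim (q ^ N) q * (1 - (1 - (q ^ N) ^ (-2 * m)) * (1 - (q ^ N) ^ (-2 * n)) *
        (diffFactor (q ^ N) q / (q ^ N - (q ^ N)⁻¹) ^ 2)) := by
  have hA : q ^ N ≠ 0 := pow_ne_zero N hq
  rw [slInvariant, rtMatrix_toLink hq, stateSum_doubleBraid _ _ (D := qdim (q ^ N) q)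
    (sum_arcWeight hq hq') (sum_arcWeight_inv hq hq') (arcWeight_mul_arcWeight_inv hq),
    writhe_doubleBraid, show -(2 * m + 2 * n) = -2 * n - 2 * m by ring, kinkCoeff_inv,
    kinkCoeff_eq]
  exact doubleBraid_value hA hq hA' hq' m n (chainCoeff_mul_qdim hA hq' n)
    (chainCoeff_mul_qdim hA hq' m)

theorem slInvariant_aptLink {N : ℕ} (hq : q ≠ 0) (hq' : q - q⁻¹ ≠ 0) (n : ℤ) :
    slInvariant N q (aptLink n).toLink =
      (q ^ N) ^ (-2 * n) * qdim (q ^ N) q ^ 2 + 1 - (q ^ N) ^ (-2 * n) := by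
  have hA : q ^ N ≠ 0 := pow_ne_zero N hq
  rw [slInvariant, rtMatrix_toLink hq, stateSum_aptLink _ _ (D := qdim (q ^ N) q)
    (sum_arcWeight hq hq') (sum_arcWeight_inv hq hq') (arcWeight_mul_arcWeight_inv hq),
    writhe_aptLink, show -(2 * n) = -2 * n by ring, kinkCoeff_inv, kinkCoeff_eq]
  exact aptLink_value hA n (chainCoeff_mul_qdim hA hq' n)

end Evaluation

/-! ### Laurent polynomials -/

section Laurent

open LaurentPolynomial

theorem ratFuncX_pow_injective : Function.Injective fun n : ℕ => (RatFunc.X : Kq) ^ n := by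
  intro a b h
  have h' : algebraMap (Polynomial ℚ) Kq (Polynomial.X ^ a) =
      algebraMap (Polynomial ℚ) Kq (Polynomial.X ^ b) := by
    simpa [map_pow, RatFunc.algebraMap_X] using h
  have := congrArg Polynomial.natDegree (RatFunc.algebraMap_injective ℚ h')
  simpa using this

theorem ratFuncX_pow_ne_one {n : ℕ} (h : n ≠ 0) : (RatFunc.X : Kq) ^ n ≠ 1 := fun e =>
  h (ratFuncX_pow_injective (e.trans (pow_zero _).symm))

theorem sub_inv_ne_zero {F : Type*} [Field F] {x : F} (hx : x ≠ 0) (h : x ^ 2 ≠ 1) :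
  x - x⁻¹ ≠ 0 := fun e => h <| by
  linear_combination x * e + mul_inv_cancel₀ hx

theorem ratFuncX_pow_sub_inv_ne_zero {N : ℕ} (h : N ≠ 0) :
    (RatFunc.X : Kq) ^ N - ((RatFunc.X : Kq) ^ N)⁻¹ ≠ 0 :=
  sub_inv_ne_zero (pow_ne_zero N RatFunc.X_ne_zero)
    (by rw [← pow_mul]; exact ratFuncX_pow_ne_one (by omega))

theorem ratFuncX_sub_inv_ne_zero : (RatFunc.X : Kq) - (RatFunc.X : Kq)⁻¹ ≠ 0 := by
  simpa using ratFuncX_pow_sub_inv_ne_zero one_ne_zero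

/-- The substitution `A = q ^ N`. -/
noncomputable def evalAt (N : ℕ) : LaurentA →+* Kq := eval₂ (RingHom.id Kq) (qPow N)

theorem evalAt_C (N : ℕ) (r : Kq) : evalAt N (C r) = r := by simp [evalAt]

theorem evalAt_T (N : ℕ) (n : ℤ) : evalAt N (T n) = (RatFunc.X ^ N : Kq) ^ n := by
  simp [evalAt, qPow]

/-- Multiplication by a power of `A` gives an honest polynomial, which vanishes at the infinitely
many distinct points `q ^ (N + 1)`. -/
theorem eq_zero_of_evalAt {p : LaurentA} (h : ∀ N, 1 ≤ N → evalAt N p = 0) : p = 0 := by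
  obtain ⟨k, f, hf⟩ := exists_T_pow p
  have hf0 : f = 0 := by
    refine Polynomial.eq_of_infinite_eval_eq _ _ ((Set.infinite_range_of_injective
      (ratFuncX_pow_injective.comp (add_left_injective 1))).mono ?_)
    rintro _ ⟨N, rfl⟩
    have := congrArg (evalAt (N + 1)) hf
    rw [map_mul, h _ (by omega), zero_mul, evalAt, eval₂_toLaurent] at this
    rw [Polynomial.eval₂_id] at this
    simpa only [Set.mem_ofPred_eq, Polynomial.eval_zero, Function.comp_apply, qPow,
      Units.val_pow_eq_pow_val, Units.val_mk0] using this
  rw [hf0, map_zero] at hf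
  have e : p = p * T k * T (-(k : ℤ)) := by
    rw [mul_assoc, ← T_add, add_neg_cancel, T_zero, mul_one]
  rw [e, ← hf, zero_mul]

theorem IsHomfly.unique {L : LinkDiagram} {H H' : LaurentA} (h : IsHomfly L H)
    (h' : IsHomfly L H') : H' = H :=
  sub_eq_zero.1 <| eq_zero_of_evalAt fun N hN => by
    rw [map_sub, sub_eq_zero]
    exact (h' N hN).trans (h N hN).symm

/-- `{A}` divides `A ^ (-2 n) - 1`. -/
theorem exists_aptFunction (n : ℤ) :
    ∃ G : LaurentA, G * (T 1 - T (-1)) = T (-2 * n) - 1 := by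
  induction n using Int.induction_on with
  | zero => exact ⟨0, by simp⟩
  | succ n ih =>
    obtain ⟨G, hG⟩ := ih
    -- `A ^ (-2 n - 1) {A} = A ^ (-2 n) - A ^ (-2 n - 2)` is the decrease from `n` to `n + 1`.
    refine ⟨G - T (-2 * n - 1), ?_⟩
    rw [sub_mul, hG, mul_sub, ← T_add, ← T_add]
    ring_nf
  | pred n ih =>
    obtain ⟨G, hG⟩ := ih
    refine ⟨G + T (-2 * -n + 1), ?_⟩
    rw [add_mul, hG, mul_sub, ← T_add, ← T_add]
    ring_nf

/-- The Laurent polynomial `(A ^ (-2 n) - 1) / {A}`. -/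
noncomputable def aptFunction (n : ℤ) : LaurentA := (exists_aptFunction n).choose

theorem aptFunction_mul (n : ℤ) : aptFunction n * (T 1 - T (-1)) = T (-2 * n) - 1 :=
  (exists_aptFunction n).choose_spec

/-- The quantum dimension as a Laurent polynomial. -/
noncomputable def qdimL : LaurentA := C (RatFunc.X - (RatFunc.X)⁻¹)⁻¹ * (T 1 - T (-1))

/-- The factor of the differential expansion as a Laurent polynomial. -/
noncomputable def diffFactorL : LaurentA :=
  (T 1 - T (-1)) ^ 2 - C ((RatFunc.X - (RatFunc.X)⁻¹) ^ 2)

/-- The HOMFLY polynomial of a double braid. -/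
noncomputable def homflyDB (m n : ℤ) : LaurentA :=
  qdimL * (1 + diffFactorL * -(aptFunction m * aptFunction n))

/-- The HOMFLY polynomial of an antiparallel torus link. -/
noncomputable def homflyAPT (n : ℤ) : LaurentA := T (-2 * n) * qdimL ^ 2 + 1 - T (-2 * n)

/-! ### Values under a homomorphism to a field, used both for `A = q ^ N` and for the inclusion into
rational functions. -/

section Map

variable {F : Type*} [Field F] (f : LaurentA →+* F)

theorem map_T_one_ne_zero : f (T 1) ≠ 0 := fun h => by
  have : f (T 1 * T (-1)) = 1 := by rw [← T_add, add_neg_cancel, T_zero, map_one]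
  rw [map_mul, h, zero_mul] at this
  exact zero_ne_one this

theorem map_T_zpow (n : ℤ) : f (T n) = f (T 1) ^ n := by
  have h := map_T_one_ne_zero f
  have hn : ∀ k : ℕ, f (T k) = f (T 1) ^ k := fun k => by rw [← map_pow, T_pow, mul_one]
  obtain ⟨k, rfl | rfl⟩ := n.eq_nat_or_neg
  · rw [hn, zpow_natCast]
  · rw [zpow_neg, zpow_natCast]
    refine eq_inv_of_mul_eq_one_left ?_
    rw [← hn, ← map_mul, ← T_add, neg_add_cancel, T_zero, map_one]

theorem map_C_inv (r : Kq) : f (C r⁻¹) = (f (C r))⁻¹ := map_inv₀ (f.comp C) r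

theorem map_qdimL : f qdimL = qdim (f (T 1)) (f (C RatFunc.X)) := by
  rw [qdimL, map_mul, map_C_inv, map_sub C, map_sub, map_sub, map_C_inv, map_T_zpow f (-1),
    zpow_neg_one, qdim, div_eq_inv_mul]

theorem map_diffFactorL : f diffFactorL = diffFactor (f (T 1)) (f (C RatFunc.X)) := by
  have hq : f (C RatFunc.X) ≠ 0 := (map_ne_zero (f.comp C)).2 RatFunc.X_ne_zero
  rw [diffFactorL, diffFactor_eq (map_T_one_ne_zero f) hq, map_sub, map_pow, map_pow C, map_pow,
    map_sub C, map_sub, map_sub, map_C_inv, map_T_zpow f (-1), zpow_neg_one]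

theorem map_aptFunction (hA : f (T 1) - (f (T 1))⁻¹ ≠ 0) (n : ℤ) :
    f (aptFunction n) = (f (T 1) ^ (-2 * n) - 1) / (f (T 1) - (f (T 1))⁻¹) := by
  rw [eq_div_iff hA, ← map_T_zpow, ← zpow_neg_one, ← map_T_zpow f (-1), ← map_sub, ← map_mul,
    aptFunction_mul, map_sub, map_one]

theorem map_homflyDB (hA : f (T 1) - (f (T 1))⁻¹ ≠ 0) (m n : ℤ) :
    f (homflyDB m n) = qdim (f (T 1)) (f (C RatFunc.X)) *
      (1 - (1 - f (T 1) ^ (-2 * m)) * (1 - f (T 1) ^ (-2 * n)) *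
        (diffFactor (f (T 1)) (f (C RatFunc.X)) / (f (T 1) - (f (T 1))⁻¹) ^ 2)) := by
  rw [homflyDB, map_mul, map_qdimL, map_add, map_one, map_mul, map_neg, map_mul,
    map_diffFactorL, map_aptFunction f hA, map_aptFunction f hA]
  field_simp
  ring

theorem map_homflyAPT (n : ℤ) :
    f (homflyAPT n) = f (T 1) ^ (-2 * n) * qdim (f (T 1)) (f (C RatFunc.X)) ^ 2 + 1 -
      f (T 1) ^ (-2 * n) := by
  rw [homflyAPT, map_sub, map_add, map_mul, map_pow, map_qdimL, map_one, map_T_zpow]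

end Map

theorem isHomfly_homflyDB (m n : ℤ) : IsHomfly (doubleBraid m n).toLink (homflyDB m n) := by
  intro N hN
  have hA : (RatFunc.X : Kq) ^ N - ((RatFunc.X : Kq) ^ N)⁻¹ ≠ 0 :=
    ratFuncX_pow_sub_inv_ne_zero (by omega)
  have e : evalAt N (T 1) = (RatFunc.X ^ N : Kq) := by rw [evalAt_T, zpow_one]
  rw [slInvariant_doubleBraid RatFunc.X_ne_zero ratFuncX_sub_inv_ne_zero hA]
  have := map_homflyDB (evalAt N) (by rw [e]; exact hA) m n
  rw [e, evalAt_C] at this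
  exact this

theorem isHomfly_homflyAPT (n : ℤ) : IsHomfly (aptLink n).toLink (homflyAPT n) := by
  intro N _
  have e : evalAt N (T 1) = (RatFunc.X ^ N : Kq) := by rw [evalAt_T, zpow_one]
  rw [slInvariant_aptLink RatFunc.X_ne_zero ratFuncX_sub_inv_ne_zero]
  have := map_homflyAPT (evalAt N) n
  rw [e, evalAt_C] at this
  exact this

theorem incl_injective : Function.Injective incl := IsFractionRing.injective LaurentA KAq

theorem Av_ne_zero : Av ≠ 0 := map_T_one_ne_zero incl

theorem qv_ne_zero : qv ≠ 0 := (map_ne_zero (incl.comp C)).2 RatFunc.X_ne_zero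

theorem qv_sub_inv_ne_zero : qv - qv⁻¹ ≠ 0 := by
  have := (map_ne_zero (incl.comp C)).2 ratFuncX_sub_inv_ne_zero
  rwa [map_sub, map_inv₀] at this

/-- Monomials are distinguished from `1` by the substitution `A = q ^ 2`. The substitution `A = q`
would not do, as it annihilates `{A / q}`. -/
theorem incl_T_mul_C_ne_one {n : ℤ} {r : Kq}
    (h : (RatFunc.X ^ 2 : Kq) ^ n * r ≠ 1) : incl (T n * C r) ≠ 1 := fun e => h <| by
  have := congrArg (evalAt 2) (incl_injective (e.trans (map_one incl).symm))
  rwa [map_mul, evalAt_T, evalAt_C, map_one] at this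

theorem Av_sub_inv_ne_zero : Av - Av⁻¹ ≠ 0 := by
  refine sub_inv_ne_zero Av_ne_zero ?_
  have h := incl_T_mul_C_ne_one (n := 2) (r := 1) (by
    rw [mul_one, ← zpow_natCast, ← zpow_mul]
    exact_mod_cast ratFuncX_pow_ne_one (n := 4) (by decide))
  rwa [map_one, mul_one, map_T_zpow] at h

theorem diffFactor_ne_zero : diffFactor Av qv ≠ 0 := by
  have hA := Av_ne_zero
  have hq := qv_ne_zero
  have hX : (RatFunc.X : Kq) ≠ 0 := RatFunc.X_ne_zero
  have h₁ : (Av * qv) ^ 2 ≠ 1 := by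
    have h := incl_T_mul_C_ne_one (n := 2) (r := RatFunc.X ^ 2) (by
      rw [zpow_ofNat, ← pow_mul, ← pow_add]
      exact ratFuncX_pow_ne_one (n := 6) (by decide))
    rw [map_mul, map_T_zpow, map_pow C, map_pow] at h
    rw [mul_pow]
    exact h
  have h₂ : (Av / qv) ^ 2 ≠ 1 := by
    have h := incl_T_mul_C_ne_one (n := 2) (r := (RatFunc.X ^ 2)⁻¹) (by
      rw [show (2 : ℤ) = 1 + 1 from rfl, zpow_add₀ (pow_ne_zero 2 hX), zpow_one, mul_assoc,
        mul_inv_cancel₀ (pow_ne_zero 2 hX), mul_one]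
      exact ratFuncX_pow_ne_one (by decide))
    rw [map_mul, map_T_zpow, map_C_inv, map_pow C, map_pow] at h
    rw [div_pow, div_eq_mul_inv]
    exact h
  exact mul_ne_zero (sub_inv_ne_zero (mul_ne_zero hA hq) h₁)
    (sub_inv_ne_zero (div_ne_zero hA hq) h₂)

theorem Dv_ne_zero : Dv ≠ 0 := div_ne_zero Av_sub_inv_ne_zero qv_sub_inv_ne_zero

theorem incl_aptFunction (n : ℤ) : incl (aptFunction n) = (Av ^ (-2 * n) - 1) / br Av :=
  map_aptFunction incl Av_sub_inv_ne_zero n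

theorem incl_homflyDB (m n : ℤ) :
    incl (homflyDB m n) = Dv * (1 - (1 - Av ^ (-2 * m)) * (1 - Av ^ (-2 * n)) *
      (br (Av * qv) * br (Av / qv) / br Av ^ 2)) :=
  map_homflyDB incl Av_sub_inv_ne_zero m n

/-- No comparison of diagrams is needed: both sides have already been brought to the same closed
form. -/
theorem incl_homflyDB_eq_planarP (m n : ℤ) :
    incl (homflyDB m n) =
      Av ^ (-2 * n - 2 * m) * planarP Dv phi phiBar (doubleBraid m n) := by
  rw [incl_homflyDB, planarP_doubleBraid]
  exact (doubleBraid_value Av_ne_zero qv_ne_zero Av_sub_inv_ne_zero qv_sub_inv_ne_zero m n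
    (chainCoeff_mul_qdim Av_ne_zero qv_sub_inv_ne_zero n)
    (chainCoeff_mul_qdim Av_ne_zero qv_sub_inv_ne_zero m)).symm

theorem chainCoeff_mul_Dv (n : ℤ) :
    chainCoeff Dv phi phiBar n * Dv = (1 + phi * Dv) ^ n - 1 := by
  refine chainCoeff_mul ?_ n
  have h₁ := one_add_mul_qdim Av_ne_zero qv_sub_inv_ne_zero
  have h₂ := one_sub_mul_qdim Av_ne_zero qv_sub_inv_ne_zero
  exact (congrArg₂ (· * ·) h₁ h₂).trans (mul_inv_cancel₀ (pow_ne_zero 2 Av_ne_zero))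

theorem incl_homflyAPT (n : ℤ) :
    incl (homflyAPT n) = Dv ^ 2 * (1 + br (Av * qv) * br (Av / qv) / br Av *
      incl (aptFunction n)) := by
  rw [incl_aptFunction]
  refine (map_homflyAPT incl n).trans ?_
  change Av ^ (-2 * n) * Dv ^ 2 + 1 - Av ^ (-2 * n) =
    Dv ^ 2 * (1 + diffFactor Av qv / br Av * _)
  rw [diffFactor_eq Av_ne_zero qv_ne_zero]
  have hA : br Av ≠ 0 := Av_sub_inv_ne_zero
  have hq : br qv ≠ 0 := qv_sub_inv_ne_zero
  change _ = Dv ^ 2 * (1 + (br Av ^ 2 - br qv ^ 2) / br Av * _)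
  rw [Dv]
  field_simp
  ring

theorem incl_homflyDB_eq (m n : ℤ) :
    incl (homflyDB m n) = Dv * (1 + br (Av * qv) * br (Av / qv) *
      incl (-(aptFunction m * aptFunction n))) := by
  rw [homflyDB, map_mul, map_qdimL, map_add, map_mul, map_diffFactorL, map_one]
  rfl

/-- Uniqueness combines that of the HOMFLY polynomial with cancellation of the nonzero factors `D`
and `{Aq}{A/q}`. -/
theorem isCyclotomicKnot_iff (m n : ℤ) (F : LaurentA) :
    IsCyclotomicKnot (doubleBraid m n).toLink F ↔ F = -(aptFunction m * aptFunction n) := by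
  constructor
  · rintro ⟨H, hH, h⟩
    rw [(isHomfly_homflyDB m n).unique hH, incl_homflyDB_eq] at h
    have h' := add_left_cancel (mul_left_cancel₀ Dv_ne_zero h)
    exact (incl_injective (mul_left_cancel₀ diffFactor_ne_zero h')).symm
  · rintro rfl
    exact ⟨_, isHomfly_homflyDB m n, incl_homflyDB_eq m n⟩

theorem isCyclotomicLink_iff (n : ℤ) (F : LaurentA) :
    IsCyclotomicLink (aptLink n).toLink F ↔ F = aptFunction n := by
  constructor
  · rintro ⟨H, hH, h⟩
    rw [(isHomfly_homflyAPT n).unique hH, incl_homflyAPT] at h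
    have h' := add_left_cancel (mul_left_cancel₀ (pow_ne_zero 2 Dv_ne_zero) h)
    exact (incl_injective (mul_left_cancel₀
      (div_ne_zero diffFactor_ne_zero Av_sub_inv_ne_zero) h')).symm
  · rintro rfl
    exact ⟨_, isHomfly_homflyAPT n, incl_homflyAPT n⟩

theorem isHomfly_doubleBraid_iff (m n : ℤ) (H : LaurentA) :
    IsHomfly (doubleBraid m n).toLink H ↔ H = homflyDB m n :=
  ⟨fun h => (isHomfly_homflyDB m n).unique h, fun h => h ▸ isHomfly_homflyDB m n⟩

theorem br_Av_ne_zero : br Av ≠ 0 := Av_sub_inv_ne_zero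

theorem br_mul_br : br (Av * qv) * br (Av / qv) = br Av ^ 2 - br qv ^ 2 :=
  diffFactor_eq Av_ne_zero qv_ne_zero

theorem incl_neg_mul_aptFunction (m n : ℤ) : incl (-(aptFunction m * aptFunction n)) =
    -((1 - Av ^ (-2 * m)) * (1 - Av ^ (-2 * n)) / br Av ^ 2) := by
  have h := br_Av_ne_zero
  rw [map_neg, map_mul, incl_aptFunction, incl_aptFunction]
  field_simp
  ring

end Laurent

end BipartiteLinks

/-! ### The main theorem. -/

theorem mainTheorem5 (m n : ℤ) :
    -- the planar state sum, for independent values of `D`, `φ`, `φ'`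
    (∀ (R : Type*) [CommRing R] (D φ φ' : R),
      planarP D φ φ' (doubleBraid m n) =
        D + (chainCoeff D φ φ' n + chainCoeff D φ φ' m) * D ^ 2 +
          chainCoeff D φ φ' n * chainCoeff D φ φ' m * D) ∧
    -- the HOMFLY polynomial
    (∃ H : LaurentA, IsHomfly (doubleBraid m n).toLink H ∧
      (∀ H' : LaurentA, IsHomfly (doubleBraid m n).toLink H' → H' = H) ∧
      incl H = Av ^ (-2 * n - 2 * m) * planarP Dv phi phiBar (doubleBraid m n) ∧
      incl H = Av ^ (-2 * n - 2 * m) * (Dv * ((1 + phi * Dv) ^ n + (1 + phi * Dv) ^ m +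
        (Dv ^ 2)⁻¹ * ((1 + phi * Dv) ^ n - 1) * ((1 + phi * Dv) ^ m - 1) - 1)) ∧
      incl H = Dv * (1 - (1 - Av ^ (-2 * m)) * (1 - Av ^ (-2 * n)) *
        (br (Av * qv) * br (Av / qv) / br Av ^ 2))) ∧
    -- the cyclotomic function and its factorisation
    (∃ F Fm Fn : LaurentA,
      (∀ F' : LaurentA, IsCyclotomicKnot (doubleBraid m n).toLink F' ↔ F' = F) ∧
      (∀ F' : LaurentA, IsCyclotomicLink (aptLink m).toLink F' ↔ F' = Fm) ∧
      (∀ F' : LaurentA, IsCyclotomicLink (aptLink n).toLink F' ↔ F' = Fn) ∧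
      incl F = (br (Av * qv))⁻¹ * (br (Av / qv))⁻¹ * (Av ^ (-2 * n - 2 * m) *
        (1 + chainCoeff Dv phi phiBar n * chainCoeff Dv phi phiBar m +
          (chainCoeff Dv phi phiBar n + chainCoeff Dv phi phiBar m) * Dv) - 1) ∧
      incl F = -((1 - Av ^ (-2 * m)) * (1 - Av ^ (-2 * n)) / br Av ^ 2) ∧
      incl Fm = (Av ^ (-2 * m) - 1) / br Av ∧
      incl Fn = (Av ^ (-2 * n) - 1) / br Av ∧
      F = -(Fm * Fn)) ∧
    -- twist knots, for both kinds of the lock element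
    (∃ H : LaurentA, (∀ H' : LaurentA, IsHomfly (twist n).toLink H' ↔ H' = H) ∧
      incl H = Dv * (Av ^ (-2 : ℤ) + Av⁻¹ * (br qv ^ 2 / br Av) +
        br (Av / qv) * br (Av * qv) / br Av * Av ^ (-2 * n - 1))) ∧
    (∃ H : LaurentA, (∀ H' : LaurentA, IsHomfly (twistBar (-n)).toLink H' ↔ H' = H) ∧
      incl H = Dv * (Av ^ 2 - Av * (br qv ^ 2 / br Av) -
        br (Av / qv) * br (Av * qv) / br Av * Av ^ (-2 * n + 1))) := by
  have hA : br Av ≠ 0 := br_Av_ne_zero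
  have hA₀ := Av_ne_zero
  have hD := Dv_ne_zero
  have hX : br (Av * qv) * br (Av / qv) ≠ 0 := diffFactor_ne_zero
  have hn := chainCoeff_mul_Dv n
  have hm := chainCoeff_mul_Dv m
  have hP := planarP_doubleBraid Dv phi phiBar m n
  have hH := incl_homflyDB_eq_planarP m n
  refine ⟨fun R _ D φ φ' => planarP_doubleBraid D φ φ' m n,
    ⟨homflyDB m n, isHomfly_homflyDB m n, fun H' h => (isHomfly_homflyDB m n).unique h,
      hH, ?_, incl_homflyDB m n⟩,
    ⟨-(aptFunction m * aptFunction n), aptFunction m, aptFunction n, isCyclotomicKnot_iff m n,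
      isCyclotomicLink_iff m, isCyclotomicLink_iff n, ?_, incl_neg_mul_aptFunction m n,
      incl_aptFunction m, incl_aptFunction n, rfl⟩,
    ⟨homflyDB 1 n, isHomfly_doubleBraid_iff 1 n, ?_⟩,
    ⟨homflyDB (-1) n, ?_, ?_⟩⟩
  -- Each `(1 + φ D) ^ n` is rewritten as `Φ_n D + 1`, which leaves an identity in `D`, `Φ_n`,
  -- `Φ_m`.
  · rw [hH, hP, ← hn, ← hm, sub_eq_iff_eq_add.1 hn.symm, sub_eq_iff_eq_add.1 hm.symm]
    generalize chainCoeff Dv phi phiBar n = x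
    generalize chainCoeff Dv phi phiBar m = y
    congr 1
    field_simp
    ring
  · rw [hP, incl_homflyDB_eq] at hH
    -- After clearing `{Aq}{A/q}` and multiplying by `D`, the claim compares two expressions for the
    -- HOMFLY polynomial.
    rw [← mul_inv, eq_inv_mul_iff_mul_eq₀ hX]
    refine mul_left_cancel₀ hD ?_
    linear_combination hH
  · rw [incl_homflyDB, br_mul_br, mul_comm (br (Av / qv)), br_mul_br]
    -- One of the two factors `{A}` in the denominator cancels, because one chain is a single lock.
    have e : 1 - Av ^ (-2 * (1 : ℤ)) = Av⁻¹ * br Av := by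
      rw [br, mul_one, zpow_neg, zpow_ofNat]
      field_simp
    have e' : Av ^ (-2 * n - 1) = Av ^ (-2 * n) * Av⁻¹ := by rw [zpow_sub_one₀ hA₀]
    have e'' : Av ^ (-2 : ℤ) = 1 - Av⁻¹ * br Av := by rw [← e, mul_one, sub_sub_cancel]
    rw [e, e', e'']
    field_simp
    ring
  -- `twistBar` negates its argument, so at `-n` it is the double braid with parameters `-1` and
  -- `n`.
  · have := isHomfly_doubleBraid_iff (-1) n
    rwa [twistBar, neg_neg]
  · rw [incl_homflyDB, br_mul_br, mul_comm (br (Av / qv)), br_mul_br]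
    have e : 1 - Av ^ (-2 * (-1 : ℤ)) = -(Av * br Av) := by
      rw [br, show -2 * (-1 : ℤ) = (2 : ℕ) by rfl, zpow_natCast, mul_sub, mul_inv_cancel₀ hA₀]
      ring
    have e' : Av ^ (-2 * n + 1) = Av ^ (-2 * n) * Av := by rw [zpow_add_one₀ hA₀]
    have e'' : Av ^ 2 = 1 + Av * br Av := by
      rw [br, mul_sub, mul_inv_cancel₀ hA₀]
      ring
    rw [e, e', e'']
    field_simp
    ring
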